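/- Let $L$ be a nearly plat front projection of a Legendrian knot (or link) in standard contact $\mathbb R^3$: it is obtained by slightly perturbing a front with all left cusps on one vertical line, all right cusps on one vertical line and all crossings at distinct $x$-coordinates, so that the cusps have distinct $x$-coordinates as well. Fronts are considered up to planar isotopy. Let $\mu$ be a $\mathbb Z$-valued Maslov potential on $L$, let $Q(L)$ be the set of crossings and right cusps of $L$, graded by $|a|=1$ for a right cusp and $|a|=\mu(T)-\mu(B)$ for a crossing of the strands $T,B$ where $T$ has the smaller slope, and let $\mathcal A(L)$ be the unital tensor algebra of the $\mathbb Z_2$-vector space with basis $Q(L)$. Strands over a vertical line are numbered from top to bottom. *The Chekanov–Eliashberg differential.* For a word $w$ in $Q(L)$ let $\Delta(a,w)$ be the set of admissible disks (up to diffeomorphism) originating at $a$, i.e. immersed disks with boundary on $L$ whose right-most point is $a$ (the disk filling the left quadrant of the crossing $a$ or the inside of the right cusp $a$), whose left-most point is a left cusp with its inside filled, whose other corners are convex corners filling the upper or lower quadrant of a crossing, and whose convex corners, read counter-clockwise from $a$, form $w$. Then $\partial a=\delta_a+\sum_w\#\Delta(a,w)\,w$ with counts mod $2$, where $\delta_a=1$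 if $a$ is a right cusp and $\delta_a=0$ otherwise, and $\partial$ is extended by linearity and the Leibniz rule. An augmentation is a unital algebra map $\epsilon:\mathcal A(L)\to\mathbb Z_2$ with $\epsilon\circ\partial=0$ and with $|q|=0$ for every generator $q$ with $\epsilon(q)=1$. It gives the automorphism $\phi^\epsilon(q)=q+\epsilon(q)$ and the differential $\partial^\epsilon=\phi^\epsilon\,\partial\,(\phi^\epsilon)^{-1}$. *Morse complex sequences.* An MCS $\mathcal C$ for $(L,\mu)$ consists of handleslide marks on $L$ (vertical segments, away from crossings and cusps, joining two strands of equal Maslov potential), vertical lines $x=x_1<\dots<x_M$ that meet $L$ and cut it into tangles each containing exactly one crossing, cusp or handleslide mark, and for each $m$ a complex $(C_m,d_m)$ over $\mathbb Z_2$ whose basis $e_1,e_2,\dots$ is the set of strands at $x_m$, graded by $\mu$, with $d_m$ of degree $-1$ and $d_me_i\in\mathrm{span}\{e_j:j>i\}$ (to the left and to the right of $L$ the complex is $0$). The complexes at the left and right border of a tangle, $(C,d)$ and $(C',d')$, are related as follows. *Crossing of strands $k,k+1$:* $\langle de_k,e_{k+1}\rangle=0$ and the transposition of $e_k,e_{k+1}$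 is an isomorphism of complexes $C\to C'$. *Left cusp with strands $k,k+1$ on its right:* $\langle d'e_k,e_{k+1}\rangle=1$, and $e_i\mapsto[e_i]$ for $i<k$, $e_i\mapsto[e_{i+2}]$ for $i\ge k$, is an isomorphism of complexes from $C$ to the quotient of $C'$ by the span of $e_k,d'e_k$. *Right cusp:* the same with $C$ and $C'$ exchanged. *Handleslide mark between strands $k<l$:* $e_k\mapsto e_k+e_l$, $e_i\mapsto e_i$ $(i\ne k)$ is an isomorphism of complexes $C\to C'$. *The MCS-DGA.* A chord $(x_m,[i,j])$, $i<j$, is a vertical segment at $x_m$ from strand $i$ down to strand $j$. A chord path with convex corners from $a\in Q(L)$ to a crossing $b$ is a finite sequence of chords on successive lines $x_m$ from right to left such that: the first chord is $[k,k+1]$ on the line just to the left of $a$, where $k,k+1$ are the strands meeting at $a$; the last chord is on the line $x_{p+1}$ just to the right of $b$ and, if strands $k,k+1$ cross at $b$, it is $[i,k]$ with $\langle d_pe_i,e_k\rangle=1$ or $[k+1,j]$ with $\langle d_pe_{k+1},e_j\rangle=1$; and the steps in between, from $[i,j]$ to the next chord on its left, are as follows. At a crossing of strands $k,k+1$: either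 the endpoints stay on their strands (not allowed for $[k,k+1]$), or $[i,k]\to[i,k]$ (a convex corner at the bottom), or $[k+1,j]\to[k+1,j]$ (a convex corner at the top). At a right cusp: the endpoints stay on their strands. At a handleslide mark between strands $k<l$: $[i,j]\to[i,j]$, or $[k,j]\to[l,j]$ if $l<j$, or $[i,l]\to[i,k]$ if $i<k$. The word of such a path consists of its top convex corners from right to left, then $b$, then its bottom convex corners from left to right. Let $\mathcal M^{\mathcal C}(a;b_1,\dots,b_n)$ be the set of these paths from $a$ with word $b_1\cdots b_n$. The MCS-DGA $(\mathcal A_{\mathcal C},d)$ is the tensor algebra on $Q(L)$ with the same grading, and $da=\sum\#\mathcal M^{\mathcal C}(a;b_1,\dots,b_n)\,b_1\cdots b_n$ (counts mod $2$, sum over all words with $n\ge1$ and $|b_1|+\dots+|b_n|=|a|-1$), extended by linearity and the Leibniz rule. *$A$-form.* $\mathcal C$ is in $A$-form if (i) it is simple: at each left cusp whose strands on its right are $k,k+1$, the differential $d'$ on its right satisfies $\langle d'e_i,e_{k+1}\rangle=0$ for $i<k$ and $\langle d'e_k,e_j\rangle=0$ for $j>k+1$; and (ii) each handleslide mark lies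 immediately to the left of a crossing and joins the two strands that cross there, with at most one mark per crossing. A crossing with such a mark is called marked. The algebra map $\epsilon_{\mathcal C}:\mathcal A(L)\to\mathbb Z_2$ corresponding to $\mathcal C$ is given by $\epsilon_{\mathcal C}(q)=1$ if $q$ is a marked crossing and $\epsilon_{\mathcal C}(q)=0$ for all other generators $q$. **Theorem.** If $\mathcal C$ is an $A$-form MCS for $L$, then $\epsilon_{\mathcal C}$ is an augmentation of $(\mathcal A(L),\partial)$, and under the identity map of the set $Q(L)$ of generators, which preserves the grading, $d=\partial^{\epsilon_{\mathcal C}}$. Hence $(\mathcal A_{\mathcal C},d)=(\mathcal A(L),\partial^{\epsilon_{\mathcal C}})$. -/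

import Mathlib

/-!
# Nearly plat fronts, their Chekanov–Eliashberg algebra, Morse complex sequences and chord paths

A generic front projection is recorded, up to isotopy of the plane through generic fronts, by the
list of its crossings and cusps from left to right.  Strands over a vertical line are numbered
`0, 1, 2, …` from top to bottom (so "strands `k` and `k + 1`" are adjacent, `k` being the upper
one).
-/

namespace Legendrian

/-- A crossing or a cusp of a front.  For a crossing the parameter `k` says that the strands `k` and
`k + 1` cross.  For a right (left) cusp, `k` and `k + 1` are the two strands which meet at the cusp,
numbered on the vertical line just to the left (right) of it. -/
inductive Singularity
  | leftCusp (k : ℕ)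
  | crossing (k : ℕ)
  | rightCusp (k : ℕ)

/-- The number of strands to the right of a singularity that has `s` strands to its left. -/
def Singularity.strandsAfter : Singularity → ℕ → ℕ
  | .leftCusp _, s => s + 2
  | .crossing _, s => s
  | .rightCusp _, s => s - 2

/-- The singularity can be placed to the right of a vertical line that meets `s` strands. -/
def Singularity.Fits : Singularity → ℕ → Prop
  | .leftCusp k, s => k ≤ s
  | .crossing k, s => k + 1 < s
  | .rightCusp k, s => k + 1 < s

/-- The number of strands over a vertical line which has exactly the first `g` singularities of the
list `w` to its left. -/
def strandCount (w : List Singularity) (g : ℕ) : ℕ :=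
  (w.take g).foldl (fun s t => t.strandsAfter s) 0

/-- A front diagram of a Legendrian link whose crossings and cusps have distinct `x`-coordinates,
given by its singularities from left to right. -/
structure Front where
  /-- The crossings and cusps, from left to right. -/
  word : List Singularity
  fits : ∀ (g : ℕ) (h : g < word.length), (word[g]).Fits (strandCount word g)
  closed : strandCount word word.length = 0

namespace Front

/-- The number of strands of `L` over a vertical line with exactly the first `g` singularities to
its left.  Such a line is called the line in gap `g`; singularity number `g` lies between the lines
in gap `g` and in gap `g + 1`. -/
def strands (L : Front) (g : ℕ) : ℕ := strandCount L.word g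

/-- `L` is nearly plat: it arises from a plat front (all left cusps on one vertical line, all right
cusps on one vertical line) by a small perturbation which makes the `x`-coordinates of the cusps
distinct.  So the left cusps come first, then the crossings, then the right cusps.  The cusps are
not nested, because before the perturbation the strands next to the cusps are paired as
`{0, 1}, {2, 3}, …`: this says that the upper strand at each cusp has an even number. -/
def IsNearlyPlat (L : Front) : Prop :=
  ∃ l c r : List ℕ, L.word = l.map .leftCusp ++ c.map .crossing ++ r.map .rightCusp ∧
    (∀ k ∈ l, Even k) ∧ (∀ k ∈ r, Even k)

end Front

/-- Renumbering of strands when two strands with numbers `k` and `k + 1` are inserted. -/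
def shift (k i : ℕ) : ℕ := if i < k then i else i + 2

/-- A Maslov potential on the front `L`: `val g i` is the value on strand `i` over the line in
gap `g`.  It is constant along strands, and at each cusp it is larger by `1` on the upper strand.
(Values at pairs `(g, i)` with `L.strands g ≤ i` play no role.) -/
structure Front.MaslovPotential (L : Front) where
  val : ℕ → ℕ → ℤ
  crossing : ∀ g k, L.word[g]? = some (.crossing k) →
    ∀ i < L.strands g, val (g + 1) (Equiv.swap k (k + 1) i) = val g i
  leftCusp : ∀ g k, L.word[g]? = some (.leftCusp k) →
    (∀ i < L.strands g, val (g + 1) (shift k i) = val g i) ∧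
      val (g + 1) k = val (g + 1) (k + 1) + 1
  rightCusp : ∀ g k, L.word[g]? = some (.rightCusp k) →
    (∀ i < L.strands (g + 1), val g (shift k i) = val (g + 1) i) ∧
      val g k = val g (k + 1) + 1

/-! ### The graded algebra -/

namespace Front

/-- The set `Q(L)` of crossings and right cusps. -/
def Generator (L : Front) : Type :=
  {q : Fin L.word.length //
    (∃ k, L.word.get q = .crossing k) ∨ (∃ k, L.word.get q = .rightCusp k)}

/-- The degree of a generator: `1` for a right cusp, and `μ(T) - μ(B)` for a crossing, where `T` is
the strand of smaller slope, that is, the one which is the upper strand to the left of it. -/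
def degree {L : Front} (μ : L.MaslovPotential) (q : L.Generator) : ℤ :=
  match L.word.get q.1 with
  | .crossing k => μ.val q.1 k - μ.val q.1 (k + 1)
  | .rightCusp _ => 1
  | .leftCusp _ => 0

/-- The unital tensor algebra over `ℤ/2` of the vector space with basis `Q(L)`. -/
abbrev Alg (L : Front) : Type := FreeAlgebra (ZMod 2) L.Generator

/-- The product of the generators in a word. -/
noncomputable def monomial {L : Front} (w : List L.Generator) : L.Alg :=
  (w.map (FreeAlgebra.ι (ZMod 2))).prod

/-- The degree of a word. -/
def wordDegree {L : Front} (μ : L.MaslovPotential) (w : List L.Generator) : ℤ :=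
  (w.map (degree μ)).sum

end Front

section Leibniz

variable {Q : Type}

/-- The algebra homomorphism `x ↦ x + D x · ε`, `ε² = 0`, where `D` is the derivation which is `f` on
generators. -/
noncomputable def leibnizHom (f : Q → FreeAlgebra (ZMod 2) Q) :
    FreeAlgebra (ZMod 2) Q →ₐ[ZMod 2]
      TrivSqZeroExt (FreeAlgebra (ZMod 2) Q) (FreeAlgebra (ZMod 2) Q) :=
  FreeAlgebra.lift (ZMod 2)
    (fun q => TrivSqZeroExt.inl (FreeAlgebra.ι (ZMod 2) q) + TrivSqZeroExt.inr (f q))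

theorem leibnizHom_ι (f : Q → FreeAlgebra (ZMod 2) Q) (q : Q) :
    leibnizHom f (FreeAlgebra.ι (ZMod 2) q) =
      TrivSqZeroExt.inl (FreeAlgebra.ι (ZMod 2) q) + TrivSqZeroExt.inr (f q) :=
  FreeAlgebra.lift_ι_apply _ _

/-- The extension of a map on generators to the free algebra over `ℤ/2` by linearity and the Leibniz
rule `D (x * y) = x * D y + D x * y` (there are no signs over `ℤ/2`). -/
noncomputable def leibnizExt (f : Q → FreeAlgebra (ZMod 2) Q) :
    FreeAlgebra (ZMod 2) Q →ₗ[ZMod 2] FreeAlgebra (ZMod 2) Q where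
  toFun x := (leibnizHom f x).snd
  map_add' x y := by simp
  map_smul' c x := by simp

theorem leibnizExt_ι (f : Q → FreeAlgebra (ZMod 2) Q) (q : Q) :
    leibnizExt f (FreeAlgebra.ι (ZMod 2) q) = f q := by
  simp only [leibnizExt, leibnizHom_ι, LinearMap.coe_mk, AddHom.coe_mk, TrivSqZeroExt.snd_add,
    TrivSqZeroExt.snd_inl, TrivSqZeroExt.snd_inr, zero_add]

theorem leibnizHom_fst (f : Q → FreeAlgebra (ZMod 2) Q) (x : FreeAlgebra (ZMod 2) Q) :
    (leibnizHom f x).fst = x := by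
  have h : (TrivSqZeroExt.fstHom (ZMod 2) (FreeAlgebra (ZMod 2) Q)
      (FreeAlgebra (ZMod 2) Q)).comp (leibnizHom f) = AlgHom.id (ZMod 2) _ := by
    ext q
    simp only [Function.comp_apply, AlgHom.comp_apply, leibnizHom_ι, AlgHom.id_apply,
      TrivSqZeroExt.fstHom_apply, TrivSqZeroExt.fst_add, TrivSqZeroExt.fst_inl,
      TrivSqZeroExt.fst_inr, add_zero]
  exact congrArg (fun F => F x) h

theorem leibnizExt_mul (f : Q → FreeAlgebra (ZMod 2) Q) (x y : FreeAlgebra (ZMod 2) Q) :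
    leibnizExt f (x * y) = x * leibnizExt f y + leibnizExt f x * y := by
  simp [leibnizExt, leibnizHom_fst]

end Leibniz

/-! ### Chords, admissible disks and the Chekanov–Eliashberg differential -/

/-- A chord `(x_m, [i, j])`: a vertical segment over the vertical line number `m = pos`, from strand
`i = top` down to strand `j = bot`. -/
structure Chord where
  pos : ℕ
  top : ℕ
  bot : ℕ

/-- There are only finitely many sequences of chords which advance by one vertical line in each step,
if each line meets finitely many strands and only finitely many lines meet a strand. -/
theorem finite_chordSeq (S : ℕ → ℕ) (N : ℕ) (hS : ∀ m, N ≤ m → S m = 0)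
    (R : Chord → Chord → Prop) (hR : ∀ c c', R c c' → c.pos = c'.pos + 1) :
    {Λ : List Chord | (∀ c ∈ Λ, c.top < c.bot ∧ c.bot < S c.pos) ∧ Λ.IsChain R}.Finite := by
  have key : ∀ n, {Λ : List Chord | (∀ c ∈ Λ, c.top < c.bot ∧ c.bot < S c.pos) ∧ Λ.IsChain R ∧
      ∀ c ∈ Λ.head?, c.pos < n}.Finite := by
    intro n
    induction n with
    | zero =>
      refine (Set.finite_singleton ([] : List Chord)).subset ?_
      rintro (_ | ⟨c, Λ⟩) ⟨_, _, h⟩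
      · rfl
      · simp at h
    | succ n ih =>
      have hfin : {c : Chord | c.pos ≤ n ∧ c.top < c.bot ∧ c.bot < S c.pos}.Finite := by
        refine ((Set.finite_Iic n).biUnion (t := fun p => (fun x : ℕ × ℕ => Chord.mk p x.1 x.2) ''
          (Set.Iio (S p) ×ˢ Set.Iio (S p))) fun p _ =>
            ((Set.finite_Iio _).prod (Set.finite_Iio _)).image _).subset ?_
        rintro ⟨p, i, j⟩ ⟨h1, h2, h3⟩
        refine Set.mem_biUnion h1 ⟨(i, j), ⟨?_, h3⟩, rfl⟩
        exact lt_trans h2 h3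
      refine ((Set.finite_singleton ([] : List Chord)).union
        (Set.Finite.image2 List.cons hfin ih)).subset ?_
      rintro (_ | ⟨c, Λ⟩) ⟨h1, h2, h3⟩
      · exact Or.inl rfl
      · refine Or.inr ⟨c, ⟨?_, h1 c (by simp)⟩, Λ, ⟨fun x hx => h1 x (by simp [hx]), h2.tail, ?_⟩, rfl⟩
        · exact Nat.lt_succ_iff.1 (h3 c (by simp))
        · rcases Λ with _ | ⟨c', Λ⟩
          · simp
          · have h4 := hR _ _ (List.isChain_cons_cons.1 h2).1
            have h5 := h3 c (by simp)
            intro x hx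
            simp only [List.head?_cons, Option.mem_def, Option.some.injEq] at hx
            subst hx
            omega
  refine (key N).subset ?_
  rintro Λ ⟨h1, h2⟩
  refine ⟨h1, h2, fun c hc => ?_⟩
  by_contra hn
  have h3 := (h1 c (List.mem_of_mem_head? hc)).2
  rw [hS _ (not_lt.1 hn)] at h3
  omega

/-- The chord `c` on the right of a crossing of the strands `k` and `k + 1`, and the chord `c'` on
its left, have their endpoints on the same strands, and the chords do not shrink to the crossing
point in between. -/
def SmoothAt (k : ℕ) (c c' : Chord) : Prop :=
  ¬ (c.top = k ∧ c.bot = k + 1) ∧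
    c'.top = Equiv.swap k (k + 1) c.top ∧ c'.bot = Equiv.swap k (k + 1) c.bot

/-- Convex corner in the lower quadrant of a crossing of the strands `k` and `k + 1`: `[k + 1, j]`
on the right of the crossing and `[k + 1, j]` on its left. -/
def TopCornerAt (k : ℕ) (c c' : Chord) : Prop :=
  c.top = k + 1 ∧ c'.top = k + 1 ∧ c'.bot = c.bot

/-- Convex corner in the upper quadrant of a crossing of the strands `k` and `k + 1`: `[i, k]`
on the right of the crossing and `[i, k]` on its left. -/
def BotCornerAt (k : ℕ) (c c' : Chord) : Prop :=
  c.bot = k ∧ c'.bot = k ∧ c'.top = c.top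

namespace Front

open Classical in
/-- The convex corner between `c` and `c'` at the top of the chords, as a word of length at most
one.  Here `slab m` is the singularity, if any, between the lines number `m` and `m + 1`. -/
noncomputable def topCorner (L : Front) (slab : ℕ → Option (Fin L.word.length)) (c c' : Chord) :
    List L.Generator :=
  if h : ∃ q : L.Generator, slab c'.pos = some q.1 ∧
      ∃ k, L.word.get q.1 = .crossing k ∧ TopCornerAt k c c' then [h.choose] else []

open Classical in
/-- The convex corner between `c` and `c'` at the bottom of the chords. -/
noncomputable def botCorner (L : Front) (slab : ℕ → Option (Fin L.word.length)) (c c' : Chord) :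
    List L.Generator :=
  if h : ∃ q : L.Generator, slab c'.pos = some q.1 ∧
      ∃ k, L.word.get q.1 = .crossing k ∧ BotCornerAt k c c' then [h.choose] else []

/-- For a sequence of chords running from right to left: the convex corners at the top, read from
right to left, then the word `t`, then the convex corners at the bottom, read from left to right. -/
noncomputable def cornerWord (L : Front) (slab : ℕ → Option (Fin L.word.length))
    (t : List L.Generator) : List Chord → List L.Generator
  | c :: c' :: Λ => L.topCorner slab c c' ++ L.cornerWord slab t (c' :: Λ) ++ L.botCorner slab c c'
  | [_] => t
  | [] => t

/-- The singularity between the lines in gap `g` and gap `g + 1`. -/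
def slab (L : Front) (g : ℕ) : Option (Fin L.word.length) :=
  if h : g < L.word.length then some ⟨g, h⟩ else none

/-- The local forms of an admissible disk between two consecutive vertical lines, away from its
originating and terminating singularities; `c` is its intersection with the right line and `c'` its
intersection with the left one.  Its boundary follows the strands of `L`, except that it may turn at
a convex corner; cusps may only be met by the interior of the disk. -/
def DiskStep (L : Front) (c c' : Chord) : Prop :=
  c.pos = c'.pos + 1 ∧
  match L.word[c'.pos]? with
  | some (.crossing k) => SmoothAt k c c' ∨ TopCornerAt k c c' ∨ BotCornerAt k c c'
  | some (.leftCusp k) => c.top = shift k c'.top ∧ c.bot = shift k c'.bot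
  | some (.rightCusp k) => c'.top = shift k c.top ∧ c'.bot = shift k c.bot
  | none => False

/-- An admissible disk on a nearly plat front, originating at the crossing or right cusp `a`: an
immersed disk with boundary on `L`, with one originating singularity (the disk fills the quadrant to
the left of the crossing `a`, resp. the inside of the right cusp `a`), one terminating singularity
(the disk fills the inside of a left cusp), and otherwise only convex corners (the disk fills the
upper or the lower quadrant of a crossing).  With these local forms the `x`-coordinate on the disk
has its maximum at the originating singularity, its minimum at the terminating singularity and no
other critical point, so that each vertical line strictly in between meets the disk in one segment
with endpoints on strands of `L`.  The disk is recorded, up to diffeomorphism, by these segments over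
the lines in the gaps of `L`, listed from right to left. -/
structure IsAdmissibleDisk (L : Front) (a : L.Generator) (D : List Chord) : Prop where
  chord : ∀ c ∈ D, c.top < c.bot ∧ c.bot < L.strands c.pos
  originates : ∃ k, (L.word.get a.1 = .crossing k ∨ L.word.get a.1 = .rightCusp k) ∧
    D.head? = some ⟨a.1, k, k + 1⟩
  step : D.IsChain L.DiskStep
  terminates : ∃ g k, L.word[g]? = some (.leftCusp k) ∧ D.getLast? = some ⟨g + 1, k, k + 1⟩

/-- The word `w(D)`: the convex corners of `D` in counter-clockwise order along the boundary,
starting at the originating singularity. -/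
noncomputable def diskWord (L : Front) (D : List Chord) : List L.Generator :=
  L.cornerWord L.slab [] D

/-- The set `Δ(a, w)` of admissible disks originating at `a` with word `w`. -/
def disks (L : Front) (a : L.Generator) (w : List L.Generator) : Set (List Chord) :=
  {D | L.IsAdmissibleDisk a D ∧ L.diskWord D = w}

/-- There are only finitely many admissible disks. -/
theorem finite_disks (L : Front) :
    {D : List Chord | ∃ a, L.IsAdmissibleDisk a D}.Finite := by
  refine (finite_chordSeq L.strands L.word.length (fun m hm => ?_) L.DiskStep
    (fun c c' h => h.1)).subset (fun D hD => ?_)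
  · have h := L.closed
    simpa [strands, strandCount, List.take_of_length_le hm] using h
  · obtain ⟨a, ha⟩ := hD
    exact ⟨ha.chord, ha.step⟩

open Classical in
/-- The Chekanov–Eliashberg differential on generators. -/
noncomputable def ceGen (L : Front) (a : L.Generator) : L.Alg :=
  (if ∃ k, L.word.get a.1 = .rightCusp k then 1 else 0) +
    ∑ᶠ w : List L.Generator, ((L.disks a w).ncard : ZMod 2) • monomial w

/-- The Chekanov–Eliashberg differential `∂` on `𝒜(L)`. -/
noncomputable def ceDiff (L : Front) : L.Alg →ₗ[ZMod 2] L.Alg := leibnizExt L.ceGen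

/-- The algebra map `ε : 𝒜(L) → ℤ/2` is an augmentation of `(𝒜(L), ∂)`. -/
def IsAugmentation {L : Front} (μ : L.MaslovPotential) (ε : L.Alg →ₐ[ZMod 2] ZMod 2) : Prop :=
  (∀ x, ε (L.ceDiff x) = 0) ∧ ∀ q : L.Generator, ε (FreeAlgebra.ι (ZMod 2) q) = 1 → degree μ q = 0

/-- The algebra map `φ^ε` with `φ^ε (q) = q + ε (q)` on generators. -/
noncomputable def phiHom {L : Front} (ε : L.Alg →ₐ[ZMod 2] ZMod 2) : L.Alg →ₐ[ZMod 2] L.Alg :=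
  FreeAlgebra.lift (ZMod 2) (fun q =>
    FreeAlgebra.ι (ZMod 2) q + algebraMap (ZMod 2) L.Alg (ε (FreeAlgebra.ι (ZMod 2) q)))

theorem phiHom_comp_self {L : Front} (ε : L.Alg →ₐ[ZMod 2] ZMod 2) :
    (phiHom ε).comp (phiHom ε) = AlgHom.id (ZMod 2) L.Alg := by
  ext q
  have h : ∀ z : ZMod 2, z + z = 0 := by decide
  simp only [phiHom, Function.comp_apply, AlgHom.comp_apply, FreeAlgebra.lift_ι_apply, map_add,
    AlgHom.commutes, add_assoc, AlgHom.id_apply]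
  rw [← map_add, h, map_zero, add_zero]

/-- `φ^ε` as an automorphism (over `ℤ/2` it is its own inverse). -/
noncomputable def phi {L : Front} (ε : L.Alg →ₐ[ZMod 2] ZMod 2) : L.Alg ≃ₐ[ZMod 2] L.Alg :=
  AlgEquiv.ofAlgHom (phiHom ε) (phiHom ε) (phiHom_comp_self ε) (phiHom_comp_self ε)

/-- The differential `∂^ε = φ^ε ∂ (φ^ε)⁻¹`. -/
noncomputable def augDiff (L : Front) (ε : L.Alg →ₐ[ZMod 2] ZMod 2) : L.Alg →ₗ[ZMod 2] L.Alg :=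
  (phi ε).toLinearMap ∘ₗ L.ceDiff ∘ₗ (phi ε).symm.toLinearMap

end Front

/-- The free algebra over `ℤ/2` on `Q` together with degrees of the generators and a linear
endomorphism (the differential). -/
structure DiffGradedFreeAlgebra (Q : Type) where
  degree : Q → ℤ
  diff : FreeAlgebra (ZMod 2) Q →ₗ[ZMod 2] FreeAlgebra (ZMod 2) Q

/-- The graded algebra `𝒜(L)` with the differential `∂^ε`. -/
noncomputable def Front.augDGA {L : Front} (μ : L.MaslovPotential)
    (ε : L.Alg →ₐ[ZMod 2] ZMod 2) : DiffGradedFreeAlgebra L.Generator where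
  degree := Front.degree μ
  diff := L.augDiff ε

/-! ### Morse complex sequences -/

/-- The vector space over `ℤ/2` with basis `e_0, …, e_{s-1}`. -/
abbrev Space (s : ℕ) : Type := Fin s →₀ ZMod 2

/-- The basis vector `e_i` (and `0` if `i` is out of range). -/
noncomputable def basisVec (s i : ℕ) : Space s :=
  if h : i < s then Finsupp.single ⟨i, h⟩ 1 else 0

/-- The coefficient `⟨d e_i, e_j⟩` (and `0` if `i` or `j` is out of range). -/
noncomputable def coeff {s : ℕ} (d : Space s →ₗ[ZMod 2] Space s) (i j : ℕ) : ZMod 2 :=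
  if h : j < s then d (basisVec s i) ⟨j, h⟩ else 0

/-- The linear map with `e_i ↦ e_{f i}`. -/
noncomputable def indexMap (s s' : ℕ) (f : ℕ → ℕ) : Space s →ₗ[ZMod 2] Space s' :=
  Finsupp.linearCombination (ZMod 2) (fun i : Fin s => basisVec s' (f i))

/-- The handleslide map `h_{k,l}`: `e_k ↦ e_k + e_l`, and `e_i ↦ e_i` for `i ≠ k`. -/
noncomputable def handleslideMap (s s' k l : ℕ) : Space s →ₗ[ZMod 2] Space s' :=
  Finsupp.linearCombination (ZMod 2) (fun i : Fin s =>
    if (i : ℕ) = k then basisVec s' k + basisVec s' l else basisVec s' i)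

/-- `f` is an isomorphism of complexes from `(Space s, d)` to `(Space s', d')`. -/
def IsComplexIso {s s' : ℕ} (f : Space s →ₗ[ZMod 2] Space s')
    (d : Space s →ₗ[ZMod 2] Space s) (d' : Space s' →ₗ[ZMod 2] Space s') : Prop :=
  Function.Bijective f ∧ ∀ v, f (d v) = d' (f v)

/-- The map `e_i ↦ [e_{shift k i}]` is an isomorphism of complexes from `(Space s, d)` to the
quotient of `(Space s', d')` by the subcomplex spanned by `e_k` and `d' e_k`.  (The differential of
the quotient is `[v] ↦ [d' v]`.) -/
def IsCuspIso {s s' : ℕ} (k : ℕ)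
    (d : Space s →ₗ[ZMod 2] Space s) (d' : Space s' →ₗ[ZMod 2] Space s') : Prop :=
  let S : Submodule (ZMod 2) (Space s') :=
    Submodule.span (ZMod 2) {basisVec s' k, d' (basisVec s' k)}
  Function.Bijective (S.mkQ ∘ₗ indexMap s s' (shift k)) ∧
    ∀ v, S.mkQ (indexMap s s' (shift k) (d v)) = S.mkQ (d' (indexMap s s' (shift k) v))

/-- An elementary marked tangle: a vertical strip containing either one singularity of the front
(with the given number) or one handleslide mark between the strands `k` and `l`. -/
inductive Tangle (N : ℕ)
  | sing (q : Fin N)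
  | handleslide (k l : ℕ)

/-- The number of the singularity in the tangle, if there is one. -/
def Tangle.sing? {N : ℕ} : Tangle N → Option (Fin N)
  | .sing q => some q
  | .handleslide _ _ => none

/-- A front together with a collection of handleslide marks, cut into elementary marked tangles by
vertical lines.  Tangle number `m` lies between the vertical lines number `m` and `m + 1`.  The
lines number `0` and `tangles.length` lie to the left and to the right of the front. -/
structure MarkedFront (L : Front) where
  tangles : List (Tangle L.word.length)
  sings : tangles.filterMap Tangle.sing? = List.finRange L.word.length

namespace MarkedFront

variable {L : Front}

/-- The gap of `L` that contains the vertical line number `m`. -/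
def gap (H : MarkedFront L) (m : ℕ) : ℕ :=
  ((H.tangles.take m).filterMap Tangle.sing?).length

/-- The number of strands over the vertical line number `m`. -/
def strands (H : MarkedFront L) (m : ℕ) : ℕ := L.strands (H.gap m)

/-- The singularity, if there is one, between the vertical lines number `m` and `m + 1`. -/
def slab (H : MarkedFront L) (m : ℕ) : Option (Fin L.word.length) :=
  H.tangles[m]?.bind Tangle.sing?

end MarkedFront

/-- A Morse complex sequence for the front `L` with Maslov potential `μ`.  The complex over the line
number `m` is `Space (strands m)` with the differential `d m`, where `e_i` has degree `μ (e_i)`; over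
the outermost lines, which do not meet `L`, it is zero. -/
structure MCS (L : Front) (μ : L.MaslovPotential) extends MarkedFront L where
  /-- All but the outermost vertical lines meet the front. -/
  meets : ∀ m, 0 < m → m < tangles.length → 0 < toMarkedFront.strands m
  /-- A handleslide mark connects two strands with the same Maslov potential. -/
  handleslide_mark : ∀ m k l, tangles[m]? = some (.handleslide k l) →
    k < l ∧ l < toMarkedFront.strands m ∧
      μ.val (toMarkedFront.gap m) k = μ.val (toMarkedFront.gap m) l
  d : ∀ m, Space (toMarkedFront.strands m) →ₗ[ZMod 2] Space (toMarkedFront.strands m)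
  d_comp_d : ∀ m v, d m (d m v) = 0
  d_degree : ∀ m i j, coeff (d m) i j ≠ 0 →
    μ.val (toMarkedFront.gap m) j = μ.val (toMarkedFront.gap m) i - 1
  d_triangular : ∀ m i j, coeff (d m) i j ≠ 0 → i < j
  crossing : ∀ m q k, tangles[m]? = some (.sing q) → L.word.get q = .crossing k →
    coeff (d m) k (k + 1) = 0 ∧
      IsComplexIso (indexMap _ _ (Equiv.swap k (k + 1))) (d m) (d (m + 1))
  leftCusp : ∀ m q k, tangles[m]? = some (.sing q) → L.word.get q = .leftCusp k →
    coeff (d (m + 1)) k (k + 1) = 1 ∧ IsCuspIso k (d m) (d (m + 1))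
  rightCusp : ∀ m q k, tangles[m]? = some (.sing q) → L.word.get q = .rightCusp k →
    coeff (d m) k (k + 1) = 1 ∧ IsCuspIso k (d (m + 1)) (d m)
  handleslide : ∀ m k l, tangles[m]? = some (.handleslide k l) →
    IsComplexIso (handleslideMap _ _ k l) (d m) (d (m + 1))

namespace MCS

variable {L : Front} {μ : L.MaslovPotential}

/-- There are no implicit handleslide marks at left cusps. -/
def IsSimple (C : MCS L μ) : Prop :=
  ∀ m q k, C.tangles[m]? = some (.sing q) → L.word.get q = .leftCusp k →
    (∀ i < k, coeff (C.d (m + 1)) i (k + 1) = 0) ∧ ∀ j > k + 1, coeff (C.d (m + 1)) k j = 0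

/-- `C` is in `A`-form: it is simple, and each handleslide mark is located immediately to the left
of a crossing and connects the two strands which cross there.  (So each crossing has at most one
mark.) -/
def IsAForm (C : MCS L μ) : Prop :=
  C.IsSimple ∧ ∀ m k l, C.tangles[m]? = some (.handleslide k l) →
    l = k + 1 ∧ ∃ q, C.tangles[m + 1]? = some (.sing q) ∧ L.word.get q = .crossing k

/-- The crossing `q` is marked: there is a handleslide mark immediately to the left of it. -/
def IsMarked (C : MCS L μ) (q : L.Generator) : Prop :=
  (∃ k, L.word.get q.1 = .crossing k) ∧
    ∃ m k l, C.tangles[m]? = some (.handleslide k l) ∧ C.tangles[m + 1]? = some (.sing q.1)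

open Classical in
/-- The algebra map `𝒜(L) → ℤ/2` which is `1` on marked crossings and `0` on all other
generators. -/
noncomputable def augmentation (C : MCS L μ) : L.Alg →ₐ[ZMod 2] ZMod 2 :=
  FreeAlgebra.lift (ZMod 2) (fun q => if C.IsMarked q then 1 else 0)

/-- The allowed successive chords of a chord path with convex corners: `c` is a chord and `c'` is
the next chord to the left of it.  (A chord path does not pass left cusps, as `L` is nearly plat.) -/
def ChordStep (C : MCS L μ) (c c' : Chord) : Prop :=
  c.pos = c'.pos + 1 ∧
  match C.tangles[c'.pos]? with
  | some (.sing q) =>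
    match L.word.get q with
    | .crossing k => SmoothAt k c c' ∨ TopCornerAt k c c' ∨ BotCornerAt k c c'
    | .leftCusp _ => False
    | .rightCusp k => c'.top = shift k c.top ∧ c'.bot = shift k c.bot
  | some (.handleslide k l) =>
    (c'.top = c.top ∧ c'.bot = c.bot) ∨
    (c.top = k ∧ l < c.bot ∧ c'.top = l ∧ c'.bot = c.bot) ∨
    (c.bot = l ∧ c.top < k ∧ c'.top = c.top ∧ c'.bot = k)
  | none => False

/-- `Λ` is a chord path with convex corners which originates at the crossing or right cusp `a` and
terminates at the crossing `b`. -/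
structure IsChordPath (C : MCS L μ) (a b : L.Generator) (Λ : List Chord) : Prop where
  chord : ∀ c ∈ Λ, c.top < c.bot ∧ c.bot < C.strands c.pos
  originates : ∃ m k, C.tangles[m]? = some (.sing a.1) ∧
    (L.word.get a.1 = .crossing k ∨ L.word.get a.1 = .rightCusp k) ∧
    Λ.head? = some ⟨m, k, k + 1⟩
  step : Λ.IsChain C.ChordStep
  terminates : ∃ p k, C.tangles[p]? = some (.sing b.1) ∧ L.word.get b.1 = .crossing k ∧
    ((∃ i, Λ.getLast? = some ⟨p + 1, i, k⟩ ∧ coeff (C.d p) i k = 1) ∨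
      (∃ j, Λ.getLast? = some ⟨p + 1, k + 1, j⟩ ∧ coeff (C.d p) (k + 1) j = 1))

/-- The set `ℳ^C(a; b_1, …, b_n)` of chord paths with convex corners which originate at `a` and
have the word `w = b_1 ⋯ b_n`: the convex corners at the top from right to left, then the crossing
where the path terminates, then the convex corners at the bottom from left to right. -/
def chordPaths (C : MCS L μ) (a : L.Generator) (w : List L.Generator) : Set (List Chord) :=
  {Λ | ∃ b, C.IsChordPath a b Λ ∧ L.cornerWord C.slab [b] Λ = w}

/-- There are only finitely many chord paths. -/
theorem finite_chordPaths (C : MCS L μ) :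
    {Λ : List Chord | ∃ a b, C.IsChordPath a b Λ}.Finite := by
  refine (finite_chordSeq C.strands C.tangles.length (fun m hm => ?_) C.ChordStep
    (fun c c' h => h.1)).subset (fun D hD => ?_)
  · have h := L.closed
    have h2 : C.gap m = L.word.length := by
      simp [MarkedFront.gap, List.take_of_length_le hm, C.sings]
    simpa [MarkedFront.strands, Front.strands, h2] using h
  · obtain ⟨a, b, ha⟩ := hD
    exact ⟨ha.chord, ha.step⟩

/-- The differential of the MCS-DGA on generators. -/
noncomputable def diffGen (C : MCS L μ) (a : L.Generator) : L.Alg :=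
  ∑ᶠ (w : List L.Generator) (_ : 1 ≤ w.length ∧ Front.wordDegree μ w = Front.degree μ a - 1),
    ((C.chordPaths a w).ncard : ZMod 2) • Front.monomial w

/-- The differential `d` of the MCS-DGA. -/
noncomputable def diff (C : MCS L μ) : L.Alg →ₗ[ZMod 2] L.Alg := leibnizExt C.diffGen

/-- The MCS-DGA `(𝒜_C, d)`: the tensor algebra on the crossings and right cusps, graded by the
Maslov potential, with the differential `d`. -/
noncomputable def dga (C : MCS L μ) : DiffGradedFreeAlgebra L.Generator where
  degree := Front.degree μ
  diff := C.diff

end MCS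

end Legendrian

namespace Legendrian

namespace Front

/-! Cut an admissible disk, or a chord path, along a vertical line: what can lie to the left of the
cut depends only on the chord `[i, j]` cut out. Let `G(i, j)` be the sum of the words of the left
parts of disks (`diskSum`), and let `F(i, j)` be the sum of the words of the left parts of chord
paths plus the coefficient `⟨d e_i, e_j⟩` (`fullSum`). The heart of the proof is `F = φ^ε (G)` on
all chords over lines that are left of the right cusps and not directly right of a mark
(`IsAForm.fullSum_eq`).

Both sides obey the same local rules from left to right. Among the left cusps there are no chord
paths, and simplicity makes the coefficients agree with the disk sums: `1` on the two new strands,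
unchanged on pairs of old strands, `0` on mixed pairs. A crossing `q` transforms `G` by `crossStep`,
in which a convex corner has weight `q`. It transforms `F` in the same way, because a path
terminating at `q` is a convex corner whose remaining left part is a coefficient of `d`
(`fullSum_crossing`). Conjugation by a handleslide changes coefficients just as chords jump along
the mark (`fullSum_handleslide`), and a jump directly left of `q` acts like a corner of weight `1`;
so a marked crossing has total weight `q + 1 = φ^ε (q)` (`crossStep_slideStep`). A right cusp adds a
correction to the coefficients, which vanishes on the pairs of adjacent strands that can meet in an
unnested right cusp (`IsAForm.fullSum_pair_eq`).

On the originating chord of `a` the coefficient is `0` at a crossing and `1` at a right cusp, where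
it cancels `δ_a`. Hence `d a = φ^ε (∂ a)` for every generator (`IsAForm.diffGen_eq_phiHom`). As
`φ^ε` shifts generators by constants, which a derivation kills, this gives `d = ∂^ε`. Finally, the
constant term of `φ^ε (x)` is `ε(x)`, and words of chord paths are nonempty, so `ε ∘ ∂ = 0`. -/

theorem monomial_nil {L : Front} : monomial ([] : List L.Generator) = 1 := rfl

theorem monomial_singleton {L : Front} (q : L.Generator) :
    monomial [q] = FreeAlgebra.ι (ZMod 2) q := by
  simp [monomial]

theorem monomial_append {L : Front} (v w : List L.Generator) :
    monomial (v ++ w) = monomial v * monomial w := by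
  simp [monomial]

end Front

/-- Counting the elements of a finite set according to the values of a function is the same as
summing over the set. -/
theorem finsum_ncard_fiber {α β M : Type*} [AddCommGroup M] [Module (ZMod 2) M] {A : Set α}
    (hA : A.Finite) (f : α → β) (g : β → M) :
    ∑ᶠ w : β, (({a | a ∈ A ∧ f a = w} : Set α).ncard : ZMod 2) • g w = ∑ᶠ a ∈ A, g (f a) := by
  classical
  lift A to Finset α using hA
  have hcard : ∀ w, ({a | a ∈ (A : Set α) ∧ f a = w} : Set α).ncard =
      (A.filter (fun a => f a = w)).card := by
    intro w
    rw [← Set.ncard_coe_finset]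
    congr 1
    ext a
    simp
  simp only [hcard]
  rw [finsum_mem_coe_finset, finsum_eq_sum_of_support_subset (s := A.image f)]
  · rw [← Finset.sum_fiberwise_of_maps_to (g := f) (t := A.image f)
      (fun a ha => Finset.mem_image_of_mem f ha)]
    refine Finset.sum_congr rfl fun w _ => ?_
    rw [Finset.sum_congr rfl (g := fun _ => g w)
      (fun a ha => by rw [(Finset.mem_filter.1 ha).2]), Finset.sum_const, Nat.cast_smul_eq_nsmul]
  · intro w hw
    rw [Function.mem_support] at hw
    by_contra hn
    apply hw
    have : A.filter (fun a => f a = w) = ∅ := by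
      ext a
      simp only [Finset.mem_filter, Finset.notMem_empty, iff_false, not_and]
      rintro ha rfl
      exact hn (by simpa using ⟨a, ha, rfl⟩)
    simp [this]

/-! ### Sums over chord sequences, treated uniformly for disks and chord paths -/

/-- The data which determine a set of chord sequences running from right to left: the number of
strands over each vertical line, the singularities between them, the allowed steps, and the chords
at which a sequence may terminal together with the word contributed there. -/
structure ChordSystem (L : Front) where
  strands : ℕ → ℕ
  size : ℕ
  strands_eq_zero : ∀ m, size ≤ m → strands m = 0
  slab : ℕ → Option (Fin L.word.length)
  step : Chord → Chord → Prop
  step_pos : ∀ c c', step c c' → c.pos = c'.pos + 1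
  terminal : Chord → Prop
  final : Chord → List L.Generator

namespace ChordSystem

variable {L : Front} (X : ChordSystem L)

/-- The chord `c` joins two strands. -/
def Valid (c : Chord) : Prop := c.top < c.bot ∧ c.bot < X.strands c.pos

/-- The chord sequences which start with the chord `c`. -/
def pathsFrom (c : Chord) : Set (List Chord) :=
  {Λ | (∀ e ∈ Λ, X.Valid e) ∧ Λ.head? = some c ∧ Λ.IsChain X.step ∧
    ∃ e, Λ.getLast? = some e ∧ X.terminal e}

/-- The word of a chord sequence. -/
noncomputable def word : List Chord → List L.Generator
  | c :: c' :: Λ => L.topCorner X.slab c c' ++ word (c' :: Λ) ++ L.botCorner X.slab c c'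
  | [c] => X.final c
  | [] => []

/-- The sum of the words of the chord sequences which start with `c`. -/
noncomputable def pathSum (c : Chord) : L.Alg :=
  ∑ᶠ Λ ∈ X.pathsFrom c, Front.monomial (X.word Λ)

theorem finite_pathsFrom (c : Chord) : (X.pathsFrom c).Finite :=
  (finite_chordSeq X.strands X.size X.strands_eq_zero X.step X.step_pos).subset
    fun _ h => ⟨h.1, h.2.2.1⟩

/-- `cornerWord` is told its innermost word in advance, whereas `word` reads it off the last chord;
only the latter form can be unfolded from the first step without knowing where the sequence ends. -/
theorem cornerWord_eq_word {Λ : List Chord} {e : Chord} (h : Λ.getLast? = some e) :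
    L.cornerWord X.slab (X.final e) Λ = X.word Λ := by
  induction Λ with
  | nil => simp at h
  | cons c Λ ih =>
    cases Λ with
    | nil =>
      simp only [List.getLast?_singleton, Option.some.injEq] at h
      simp [Front.cornerWord, word, h]
    | cons c' Λ =>
      rw [List.getLast?_cons_cons] at h
      simp [Front.cornerWord, word, ih h]

-- A sequence either stops at `c` or has a second chord; `s` lists the possible second chords.
open Classical in
theorem pathsFrom_eq {c : Chord} (hc : X.Valid c) {s : Finset Chord}
    (hs : ∀ c', c' ∈ s ↔ X.step c c') :
    X.pathsFrom c = (if X.terminal c then {[c]} else ∅) ∪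
      ⋃ c' ∈ (s : Set Chord), List.cons c '' X.pathsFrom c' := by
  ext Λ
  simp only [Set.mem_union, Set.mem_iUnion, Set.mem_image, Finset.mem_coe, hs]
  constructor
  · rintro ⟨h1, h2, h3, e, h4, h5⟩
    rcases Λ with _ | ⟨x, _ | ⟨c', Λ⟩⟩
    · simp at h2
    · left
      simp only [List.head?_cons, Option.some.injEq] at h2
      simp only [List.getLast?_singleton, Option.some.injEq] at h4
      subst h2
      subst h4
      simp [h5]
    · right
      simp only [List.head?_cons, Option.some.injEq] at h2
      subst h2
      rw [List.isChain_cons_cons] at h3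
      rw [List.getLast?_cons_cons] at h4
      exact ⟨c', h3.1, c' :: Λ, ⟨fun e he => h1 e (List.mem_cons_of_mem _ he), rfl, h3.2, e, h4, h5⟩,
        rfl⟩
  · rintro (h | ⟨c', h1, Λ', ⟨h2, h3, h4, e, h5, h6⟩, rfl⟩)
    · split_ifs at h with h1
      · rw [Set.mem_singleton_iff] at h
        subst h
        exact ⟨by simpa using hc, rfl, List.isChain_singleton _, c, rfl, h1⟩
      · exact absurd h (Set.notMem_empty _)
    · rcases Λ' with _ | ⟨x, Λ⟩
      · simp at h3
      · simp only [List.head?_cons, Option.some.injEq] at h3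
        subst h3
        refine ⟨?_, rfl, List.isChain_cons_cons.2 ⟨h1, h4⟩, e, ?_, h6⟩
        · intro e he
          rcases List.mem_cons.1 he with rfl | he
          · exact hc
          · exact h2 e he
        · rw [List.getLast?_cons_cons, h5]

open Classical in
/-- The recursion for the sums over chord sequences, by the first step. -/
theorem pathSum_eq {c : Chord} (hc : X.Valid c) (s : Finset Chord)
    (hs : ∀ c', c' ∈ s ↔ X.step c c') :
    X.pathSum c = (if X.terminal c then Front.monomial (X.final c) else 0) +
      ∑ c' ∈ s, Front.monomial (L.topCorner X.slab c c') * X.pathSum c' *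
        Front.monomial (L.botCorner X.slab c c') := by
  have hfin : ∀ c' ∈ (s : Set Chord), (List.cons c '' X.pathsFrom c').Finite :=
    fun c' _ => (X.finite_pathsFrom c').image _
  rw [pathSum, X.pathsFrom_eq hc hs, finsum_mem_union, finsum_mem_biUnion, finsum_mem_coe_finset]
  · congr 1
    · split_ifs with h
      · rw [finsum_mem_singleton, word]
      · rw [finsum_mem_empty]
    · refine Finset.sum_congr rfl fun c' _ => ?_
      rw [finsum_mem_image List.cons_injective.injOn, pathSum, mul_finsum_mem' _ _
        (X.finite_pathsFrom c'), finsum_mem_mul' _ _ (X.finite_pathsFrom c')]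
      refine finsum_mem_congr rfl fun Λ hΛ => ?_
      rcases Λ with _ | ⟨x, Λ⟩
      · simp [pathsFrom] at hΛ
      · have hx := hΛ.2.1
        simp only [List.head?_cons, Option.some.injEq] at hx
        subst hx
        rw [word, Front.monomial_append, Front.monomial_append]
  -- Sequences with different second chords are different, since the second chord is the head of the
  -- tail.
  · intro c₁ _ c₂ _ h12
    refine Set.disjoint_left.2 ?_
    rintro _ ⟨Λ, h1, rfl⟩ ⟨Λ', h2, h3⟩
    rw [List.cons_injective h3] at h2
    exact h12 (Option.some.inj (h1.2.1.symm.trans h2.2.1))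
  · exact s.finite_toSet
  · exact hfin
  -- The one-chord sequence is not among the longer ones: its tail is empty and has no head.
  · refine Set.disjoint_left.2 fun Λ h1 h2 => ?_
    simp only [Set.mem_iUnion, Set.mem_image] at h2
    obtain ⟨c', _, Λ', h3, rfl⟩ := h2
    split_ifs at h1
    · simp only [Set.mem_singleton_iff, List.cons.injEq, true_and] at h1
      subst h1
      simp [pathsFrom] at h3
    · exact h1
  · split_ifs <;> simp
  · exact s.finite_toSet.biUnion hfin

/-- The degree of the word of a chord sequence is determined by its first chord, if this is so
locally. -/
theorem wordDegree_word (μ : L.MaslovPotential) (δ : Chord → ℤ)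
    (hterm : ∀ c, X.Valid c → X.terminal c → Front.wordDegree μ (X.final c) = δ c)
    (hstep : ∀ c c', X.Valid c → X.Valid c' → X.step c c' →
      Front.wordDegree μ (L.topCorner X.slab c c') + δ c' +
        Front.wordDegree μ (L.botCorner X.slab c c') = δ c)
    {c : Chord} {Λ : List Chord} (hΛ : Λ ∈ X.pathsFrom c) :
    Front.wordDegree μ (X.word Λ) = δ c := by
  induction Λ generalizing c with
  | nil => simp [pathsFrom] at hΛ
  | cons x Λ ih =>
    obtain ⟨h1, h2, h3, e, h4, h5⟩ := hΛ
    simp only [List.head?_cons, Option.some.injEq] at h2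
    subst h2
    cases Λ with
    | nil =>
      simp only [List.getLast?_singleton, Option.some.injEq] at h4
      subst h4
      exact hterm _ (h1 _ (by simp)) h5
    | cons c' Λ =>
      rw [List.isChain_cons_cons] at h3
      rw [List.getLast?_cons_cons] at h4
      have h6 := ih (c := c') ⟨fun e he => h1 e (List.mem_cons_of_mem _ he), rfl, h3.2, e, h4, h5⟩
      have h7 := hstep _ _ (h1 _ (by simp)) (h1 c' (by simp)) h3.1
      rw [word, ← h7, ← h6]
      simp [Front.wordDegree, add_assoc]

end ChordSystem

/-! ### Corners and local recursions at a single slab -/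

/-- A crossing as a generator. -/
def Front.crossingGen {L : Front} (q : Fin L.word.length) {k : ℕ}
    (hk : L.word.get q = .crossing k) : L.Generator := ⟨q, Or.inl ⟨k, hk⟩⟩

namespace Front

variable {L : Front} {slab : ℕ → Option (Fin L.word.length)} {c c' : Chord}
  {q : Fin L.word.length} {k : ℕ}

-- The slab contains at most one singularity, so the generator selected by `choose` must be the
-- crossing `q`.
open Classical in
theorem topCorner_crossing (hs : slab c'.pos = some q) (hk : L.word.get q = .crossing k) :
    L.topCorner slab c c' = if TopCornerAt k c c' then [crossingGen q hk] else [] := by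
  unfold topCorner
  have hiff : (∃ q : L.Generator, slab c'.pos = some q.1 ∧
      ∃ k, L.word.get q.1 = .crossing k ∧ TopCornerAt k c c') ↔ TopCornerAt k c c' := by
    constructor
    · rintro ⟨q', h1, k', h2, h3⟩
      rw [hs, Option.some.injEq] at h1
      rw [← h1, hk, Singularity.crossing.injEq] at h2
      rwa [h2]
    · exact fun h => ⟨crossingGen q hk, hs, k, hk, h⟩
  split_ifs with h1 h2 h2
  · have h3 := Option.some.inj (hs.symm.trans h1.choose_spec.1)
    exact congrArg (fun x => [x]) (Subtype.ext h3.symm)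
  · exact absurd (hiff.1 h1) h2
  · exact absurd (hiff.2 h2) h1
  · rfl

open Classical in
theorem botCorner_crossing (hs : slab c'.pos = some q) (hk : L.word.get q = .crossing k) :
    L.botCorner slab c c' = if BotCornerAt k c c' then [crossingGen q hk] else [] := by
  unfold botCorner
  have hiff : (∃ q : L.Generator, slab c'.pos = some q.1 ∧
      ∃ k, L.word.get q.1 = .crossing k ∧ BotCornerAt k c c') ↔ BotCornerAt k c c' := by
    constructor
    · rintro ⟨q', h1, k', h2, h3⟩
      rw [hs, Option.some.injEq] at h1
      rw [← h1, hk, Singularity.crossing.injEq] at h2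
      rwa [h2]
    · exact fun h => ⟨crossingGen q hk, hs, k, hk, h⟩
  split_ifs with h1 h2 h2
  · have h3 := Option.some.inj (hs.symm.trans h1.choose_spec.1)
    exact congrArg (fun x => [x]) (Subtype.ext h3.symm)
  · exact absurd (hiff.1 h1) h2
  · exact absurd (hiff.2 h2) h1
  · rfl

theorem topCorner_eq_nil (h : ∀ q, slab c'.pos = some q → ∀ k, L.word.get q ≠ .crossing k) :
    L.topCorner slab c c' = [] := by
  unfold topCorner
  rw [dif_neg]
  rintro ⟨q, h1, k, h2, -⟩
  exact h _ h1 k h2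

theorem botCorner_eq_nil (h : ∀ q, slab c'.pos = some q → ∀ k, L.word.get q ≠ .crossing k) :
    L.botCorner slab c c' = [] := by
  unfold botCorner
  rw [dif_neg]
  rintro ⟨q, h1, k, h2, -⟩
  exact h _ h1 k h2

end Front

/-- The effect of a crossing of the strands `k` and `k + 1` on the sums over chord sequences, where
each convex corner contributes the factor `x`. -/
def crossStep {A : Type*} [Ring A] (k : ℕ) (x : A) (f : ℕ → ℕ → A) (i j : ℕ) : A :=
  (if i = k ∧ j = k + 1 then 0 else f (Equiv.swap k (k + 1) i) (Equiv.swap k (k + 1) j)) +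
    (if i = k + 1 then x * f (k + 1) j else 0) + (if j = k then f i k * x else 0)

namespace ChordSystem

variable {L : Front} (X : ChordSystem L) {g i j k : ℕ} {q : Fin L.word.length}

-- Disks and chord paths have the same moves at a crossing, so the recursion is proved once for
-- both. A top corner puts its generator on the left of the word, a bottom corner on the right. Top
-- corners need `i = k + 1` and bottom corners `j = k`; since `i < j`, at most one kind is
-- available.
open Classical in
theorem pathSum_crossing (hs : X.slab g = some q) (hk : L.word.get q = .crossing k)
    (hstep : ∀ c c', c'.pos = g → (X.step c c' ↔ c.pos = c'.pos + 1 ∧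
      (SmoothAt k c c' ∨ TopCornerAt k c c' ∨ BotCornerAt k c c')))
    (hc : X.Valid ⟨g + 1, i, j⟩) :
    X.pathSum ⟨g + 1, i, j⟩ =
      (if X.terminal ⟨g + 1, i, j⟩ then Front.monomial (X.final ⟨g + 1, i, j⟩) else 0) +
      crossStep k (FreeAlgebra.ι (ZMod 2) (Front.crossingGen q hk))
        (fun i j => X.pathSum ⟨g, i, j⟩) i j := by
  have hij : i < j := hc.1
  have hstep' : ∀ c', X.step ⟨g + 1, i, j⟩ c' ↔ c'.pos = g ∧
      (SmoothAt k ⟨g + 1, i, j⟩ c' ∨ TopCornerAt k ⟨g + 1, i, j⟩ c' ∨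
        BotCornerAt k ⟨g + 1, i, j⟩ c') := by
    intro c'
    constructor
    · intro h
      have h1 : g + 1 = c'.pos + 1 := X.step_pos _ _ h
      have h2 : c'.pos = g := by omega
      exact ⟨h2, ((hstep _ _ h2).1 h).2⟩
    · rintro ⟨h1, h2⟩
      exact (hstep _ _ h1).2 ⟨by rw [h1], h2⟩
  have htop : ∀ a b, L.topCorner X.slab ⟨g + 1, i, j⟩ ⟨g, a, b⟩ =
      if TopCornerAt k ⟨g + 1, i, j⟩ ⟨g, a, b⟩ then [Front.crossingGen q hk] else [] :=
    fun a b => Front.topCorner_crossing hs hk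
  have hbot : ∀ a b, L.botCorner X.slab ⟨g + 1, i, j⟩ ⟨g, a, b⟩ =
      if BotCornerAt k ⟨g + 1, i, j⟩ ⟨g, a, b⟩ then [Front.crossingGen q hk] else [] :=
    fun a b => Front.botCorner_crossing hs hk
  -- This chord would shrink to the crossing point, and it touches neither corner, so it has no
  -- successor.
  by_cases h1 : i = k ∧ j = k + 1
  · obtain ⟨rfl, rfl⟩ := h1
    rw [X.pathSum_eq hc ∅]
    · simp [crossStep]
    · rintro ⟨p, a, b⟩
      rw [hstep']
      simp [SmoothAt, TopCornerAt, BotCornerAt]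
  -- The upper endpoint either follows its strand to number `k` or turns at the crossing and keeps
  -- number `k + 1`.
  by_cases h2 : i = k + 1
  · subst h2
    have e1 : Equiv.swap k (k + 1) j = j := Equiv.swap_apply_of_ne_of_ne (by omega) (by omega)
    have hj : j ≠ k := by omega
    rw [X.pathSum_eq hc {⟨g, k, j⟩, ⟨g, k + 1, j⟩}]
    · rw [Finset.sum_pair (by simp), htop, htop, hbot, hbot]
      simp [crossStep, TopCornerAt, BotCornerAt, hj, e1, Front.monomial_nil,
        Front.monomial_singleton]
    · rintro ⟨p, a, b⟩
      rw [hstep']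
      simp only [Finset.mem_insert, Finset.mem_singleton, SmoothAt, TopCornerAt, BotCornerAt,
        Chord.mk.injEq, Equiv.swap_apply_right, e1]
      constructor
      · rintro (⟨rfl, rfl, rfl⟩ | ⟨rfl, rfl, rfl⟩) <;> simp
      · rintro ⟨rfl, ⟨-, rfl, rfl⟩ | ⟨-, rfl, rfl⟩ | ⟨rfl, -⟩⟩ <;> simp at hj ⊢
  by_cases h3 : j = k
  · subst h3
    have e1 : Equiv.swap j (j + 1) i = i := Equiv.swap_apply_of_ne_of_ne (by omega) (by omega)
    have hi : i ≠ j := by omega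
    rw [X.pathSum_eq hc {⟨g, i, j + 1⟩, ⟨g, i, j⟩}]
    · rw [Finset.sum_pair (by simp), htop, htop, hbot, hbot]
      simp [crossStep, TopCornerAt, BotCornerAt, h2, e1, Front.monomial_nil,
        Front.monomial_singleton]
    · rintro ⟨p, a, b⟩
      rw [hstep']
      simp only [Finset.mem_insert, Finset.mem_singleton, SmoothAt, TopCornerAt, BotCornerAt,
        Chord.mk.injEq, Equiv.swap_apply_left, e1]
      constructor
      · rintro (⟨rfl, rfl, rfl⟩ | ⟨rfl, rfl, rfl⟩) <;> simp
      · rintro ⟨rfl, ⟨-, rfl, rfl⟩ | ⟨h, -⟩ | ⟨-, rfl, rfl⟩⟩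
        · simp
        · exact absurd h h2
        · simp
  · rw [X.pathSum_eq hc {⟨g, Equiv.swap k (k + 1) i, Equiv.swap k (k + 1) j⟩}]
    · rw [Finset.sum_singleton, htop, hbot]
      simp [crossStep, TopCornerAt, BotCornerAt, h1, h2, h3, Front.monomial_nil]
    · rintro ⟨p, a, b⟩
      rw [hstep']
      simp only [Finset.mem_singleton, SmoothAt, TopCornerAt, BotCornerAt, Chord.mk.injEq, h1, h2,
        h3]
      tauto

-- Away from crossings there are no corners, so each successor contributes with weight one.
open Classical in
theorem pathSum_of_not_crossing (hs : ∀ q, X.slab g = some q → ∀ k, L.word.get q ≠ .crossing k)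
    (hc : X.Valid ⟨g + 1, i, j⟩) (s : Finset (ℕ × ℕ))
    (hstep : ∀ a b, X.step ⟨g + 1, i, j⟩ ⟨g, a, b⟩ ↔ (a, b) ∈ s) :
    X.pathSum ⟨g + 1, i, j⟩ =
      (if X.terminal ⟨g + 1, i, j⟩ then Front.monomial (X.final ⟨g + 1, i, j⟩) else 0) +
      ∑ p ∈ s, X.pathSum ⟨g, p.1, p.2⟩ := by
  have hinj : Function.Injective (fun p : ℕ × ℕ => Chord.mk g p.1 p.2) := by
    rintro ⟨a, b⟩ ⟨a', b'⟩ h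
    simpa using h
  rw [X.pathSum_eq hc (s.image fun p => Chord.mk g p.1 p.2), Finset.sum_image hinj.injOn]
  · congr 1
    refine Finset.sum_congr rfl fun p _ => ?_
    rw [Front.topCorner_eq_nil hs, Front.botCorner_eq_nil hs, Front.monomial_nil, one_mul, mul_one]
  · rintro ⟨p, a, b⟩
    simp only [Finset.mem_image, Chord.mk.injEq, Prod.exists]
    constructor
    · rintro ⟨a', b', h, rfl, rfl, rfl⟩
      exact (hstep _ _).2 h
    · intro h
      obtain rfl : g = p := by
        have h1 : g + 1 = p + 1 := X.step_pos _ _ h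
        omega
      exact ⟨a, b, (hstep _ _).1 h, rfl, rfl, rfl⟩

end ChordSystem

/-! ### Renumbering of strands, and matrix coefficients of the differentials -/

theorem shift_injective (k : ℕ) : Function.Injective (shift k) := by
  intro i j h
  unfold shift at h
  split_ifs at h <;> omega

theorem shift_of_lt {k i : ℕ} (h : i < k) : shift k i = i := if_pos h

theorem shift_of_le {k i : ℕ} (h : k ≤ i) : shift k i = i + 2 := if_neg (by omega)

theorem shift_ne_self (k i : ℕ) : shift k i ≠ k := by
  unfold shift
  split_ifs <;> omega

theorem shift_ne_succ (k i : ℕ) : shift k i ≠ k + 1 := by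
  unfold shift
  split_ifs <;> omega

theorem exists_shift_eq {k i : ℕ} (h : i ≠ k) (h' : i ≠ k + 1) : ∃ j, shift k j = i := by
  by_cases hi : i < k
  · exact ⟨i, shift_of_lt hi⟩
  · exact ⟨i - 2, by rw [shift_of_le (by omega)]; omega⟩

theorem shift_lt_shift {k i j : ℕ} : shift k i < shift k j ↔ i < j := by
  unfold shift
  split_ifs <;> omega

theorem shift_lt {k i s : ℕ} (h : k ≤ s) : shift k i < s + 2 ↔ i < s := by
  unfold shift
  split_ifs <;> omega

theorem swap_succ_lt {k i s : ℕ} (h : k + 1 < s) : Equiv.swap k (k + 1) i < s ↔ i < s := by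
  rw [Equiv.swap_apply_def]
  split_ifs <;> omega

theorem zmod_two_add_self (a : ZMod 2) : a + a = 0 := CharTwo.add_self_eq_zero a

section Coefficients

variable {s s' : ℕ}

theorem basisVec_apply (i j : ℕ) (hj : j < s) :
    basisVec s i ⟨j, hj⟩ = if i = j then 1 else 0 := by
  unfold basisVec
  split_ifs with h1 h2 h2
  · subst h2
    simp
  · rw [Finsupp.single_apply, if_neg (by simpa using h2)]
  · exact absurd (h2 ▸ hj) h1
  · rfl

theorem basisVec_val (i : Fin s) : basisVec s i = Finsupp.single i 1 := by
  simp [basisVec]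

theorem coeff_of_lt (d : Space s →ₗ[ZMod 2] Space s) (i : ℕ) {j : ℕ} (hj : j < s) :
    coeff d i j = d (basisVec s i) ⟨j, hj⟩ := dif_pos hj

theorem indexMap_basisVec (f : ℕ → ℕ) {i : ℕ} (hi : i < s) :
    indexMap s s' f (basisVec s i) = basisVec s' (f i) := by
  simp [basisVec, hi, indexMap]

theorem indexMap_apply (f : ℕ → ℕ) (v : Space s) {j : ℕ} (hj : j < s') :
    indexMap s s' f v ⟨j, hj⟩ = ∑ i : Fin s, if f i = j then v i else 0 := by
  rw [indexMap, Finsupp.linearCombination_apply, Finsupp.sum_fintype _ _ (by simp)]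
  simp [Finsupp.finsetSum_apply, basisVec_apply]

theorem indexMap_apply_of_injective {f : ℕ → ℕ} (hf : Function.Injective f) (v : Space s) {j : ℕ}
    (hj : j < s) (hj' : f j < s') : indexMap s s' f v ⟨f j, hj'⟩ = v ⟨j, hj⟩ := by
  rw [indexMap_apply, Finset.sum_eq_single ⟨j, hj⟩]
  · simp
  · intro b _ hb
    rw [if_neg]
    intro h
    exact hb (Fin.ext (hf h))
  · simp

theorem indexMap_apply_of_ne {f : ℕ → ℕ} {j : ℕ} (h : ∀ i, f i ≠ j) (v : Space s) (hj : j < s') :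
    indexMap s s' f v ⟨j, hj⟩ = 0 := by
  rw [indexMap_apply]
  simp [h]

theorem handleslideMap_basisVec (k l : ℕ) {i : ℕ} (hi : i < s) :
    handleslideMap s s' k l (basisVec s i) =
      if i = k then basisVec s' k + basisVec s' l else basisVec s' i := by
  simp [basisVec, hi, handleslideMap]

theorem handleslideMap_apply {k l : ℕ} (hk : k < s) (v : Space s) {j : ℕ} (hj : j < s)
    (hj' : j < s') :
    handleslideMap s s' k l v ⟨j, hj'⟩ = v ⟨j, hj⟩ + if j = l then v ⟨k, hk⟩ else 0 := by
  have h : ∀ i : Fin s, (v i • (if (i : ℕ) = k then basisVec s' k + basisVec s' l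
      else basisVec s' i)) ⟨j, hj'⟩ =
      (if i = ⟨j, hj⟩ then v i else 0) + if i = ⟨k, hk⟩ then (if j = l then v i else 0) else 0 := by
    intro i
    simp only [Fin.ext_iff, Finsupp.smul_apply, smul_eq_mul]
    by_cases h1 : (i : ℕ) = k
    · simp only [h1, if_true, Finsupp.add_apply, basisVec_apply, mul_add]
      simp [eq_comm]
    · simp [h1, basisVec_apply]
  rw [handleslideMap, Finsupp.linearCombination_apply, Finsupp.sum_fintype _ _ (by simp),
    Finsupp.finsetSum_apply, Finset.sum_congr rfl fun i _ => h i, Finset.sum_add_distrib]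
  simp

theorem apply_eq_sum_coeff (d : Space s →ₗ[ZMod 2] Space s) (v : Space s) {j : ℕ} (hj : j < s) :
    d v ⟨j, hj⟩ = ∑ i : Fin s, v i * coeff d i j := by
  conv_lhs => rw [← Finsupp.univ_sum_single v]
  rw [map_sum, Finsupp.finsetSum_apply]
  refine Finset.sum_congr rfl fun i _ => ?_
  rw [coeff_of_lt d _ hj, basisVec_val, ← smul_eq_mul, ← Finsupp.smul_apply, ← map_smul,
    Finsupp.smul_single, smul_eq_mul, mul_one]

theorem sum_coeff_mul_coeff {d : Space s →ₗ[ZMod 2] Space s} (hd : ∀ v, d (d v) = 0) (i : ℕ) {j : ℕ}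
    (hj : j < s) : ∑ l : Fin s, coeff d i l * coeff d l j = 0 := by
  have h := apply_eq_sum_coeff d (d (basisVec s i)) hj
  rw [hd, Finsupp.zero_apply] at h
  rw [h]
  refine Finset.sum_congr rfl fun l _ => ?_
  rw [coeff_of_lt d i l.2]

variable {d : Space s →ₗ[ZMod 2] Space s} {d' : Space s' →ₗ[ZMod 2] Space s'}

theorem coeff_eq_of_indexMap {f : ℕ → ℕ} (hf : Function.Injective f)
    (h : IsComplexIso (indexMap s s' f) d d') {i j : ℕ} (hi : i < s) (hj : j < s)
    (hj' : f j < s') : coeff d' (f i) (f j) = coeff d i j := by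
  have h1 := congrArg (fun v => v ⟨f j, hj'⟩) (h.2 (basisVec s i))
  simp only [indexMap_basisVec f hi, indexMap_apply_of_injective hf _ hj hj'] at h1
  rw [coeff_of_lt _ _ hj', coeff_of_lt _ _ hj, h1]

/-- This is the `e_j`-coefficient of `h d e_i = d' h e_i`: the extra term on the left comes from `h
e_k = e_k + e_l` applied inside `d e_i`, the one on the right from `h e_i` when `i = k`. -/
theorem coeff_handleslide {k l : ℕ} (h : IsComplexIso (handleslideMap s s' k l) d d') {i j : ℕ}
    (hss : s' = s) (hk : k < s) (hi : i < s) (hj : j < s) :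
    coeff d i j + (if j = l then coeff d i k else 0) =
      coeff d' i j + if i = k then coeff d' l j else 0 := by
  subst hss
  have h1 := congrArg (fun v => v ⟨j, hj⟩) (h.2 (basisVec s' i))
  simp only [handleslideMap_basisVec k l hi, handleslideMap_apply hk _ hj hj] at h1
  rw [coeff_of_lt d i hj, coeff_of_lt d i hk, coeff_of_lt d' i hj, coeff_of_lt d' l hj, h1]
  split_ifs with h2
  · subst h2
    simp
  · simp

/-- Gaussian elimination: cancelling `e_k` against `e_{k+1}` adds a zigzag through the cancelled
pair to each coefficient. -/
theorem coeff_cusp {k : ℕ} (h : IsCuspIso k d d') (hkk : coeff d' k k = 0)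
    (hk1 : coeff d' k (k + 1) = 1) (hss : s' = s + 2) (hk : k ≤ s) {i j : ℕ} (hi : i < s)
    (hj : j < s) :
    coeff d i j = coeff d' (shift k i) (shift k j) +
      coeff d' (shift k i) (k + 1) * coeff d' k (shift k j) := by
  subst hss
  have hjs : shift k j < s + 2 := (shift_lt hk).2 hj
  have hk1s : k + 1 < s + 2 := by omega
  have h1 := h.2 (basisVec s i)
  simp only [Submodule.mkQ_apply, Submodule.Quotient.eq, indexMap_basisVec (shift k) hi] at h1
  obtain ⟨a, b, hab⟩ := Submodule.mem_span_pair.1 h1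
  -- The `e_{k+1}`-coefficient determines `b`: the image of `shift k` misses `k + 1`, and `d' e_k`
  -- has coefficient `1` there. In the second comparison `e_k` drops out because `shift k j ≠ k`.
  have e1 := congrArg (fun v => v ⟨k + 1, hk1s⟩) hab
  have e2 := congrArg (fun v => v ⟨shift k j, hjs⟩) hab
  simp only [Finsupp.add_apply, Finsupp.smul_apply, Finsupp.sub_apply, smul_eq_mul,
    indexMap_apply_of_ne (shift_ne_succ k), indexMap_apply_of_injective (shift_injective k) _ hj,
    basisVec_apply, ← coeff_of_lt, hk1] at e1 e2
  rw [if_neg (by omega), CharTwo.sub_eq_add] at e1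
  rw [if_neg (shift_ne_self k j).symm, CharTwo.sub_eq_add] at e2
  simp only [mul_zero, zero_add, mul_one] at e1 e2
  rw [← e1, e2, add_comm, add_assoc, zmod_two_add_self, add_zero]

/-- The differential to the right of a left cusp without implicit handleslide marks. -/
theorem coeff_simple_leftCusp {k : ℕ} (h : IsCuspIso k d d') (hdd : ∀ v, d' (d' v) = 0)
    (htri : ∀ i j, coeff d' i j ≠ 0 → i < j) (hk1 : coeff d' k (k + 1) = 1)
    (hleft : ∀ i < k, coeff d' i (k + 1) = 0) (hright : ∀ j > k + 1, coeff d' k j = 0)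
    (hss : s' = s + 2) (hk : k ≤ s) :
    (∀ i j, i < s → j < s → coeff d' (shift k i) (shift k j) = coeff d i j) ∧
      ∀ i j, i < s' → j < s' → (i ≠ k ∨ j ≠ k + 1) → (i = k ∨ i = k + 1 ∨ j = k ∨ j = k + 1) →
        coeff d' i j = 0 := by
  have htri' : ∀ i j, j ≤ i → coeff d' i j = 0 := by
    intro i j hij
    by_contra hn
    exact absurd (htri i j hn) (by omega)
  -- With triangularity this says `d' e_k = e_{k+1}`.
  have hrow : ∀ j, j ≠ k + 1 → coeff d' k j = 0 := by
    intro j hj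
    by_cases hjk : j ≤ k
    · exact htri' _ _ hjk
    · exact hright j (by omega)
  have hk1s : k + 1 < s' := by omega
  have hks : k < s' := by omega
  refine ⟨fun i j hi hj => ?_, fun i j hi hj hij h1 => ?_⟩
  · rw [coeff_cusp h (htri' _ _ le_rfl) hk1 hss hk hi hj, hrow _ (shift_ne_succ k j), mul_zero,
      add_zero]
  · by_cases hik : i = k
    · subst hik
      exact hrow j (by simpa using hij)
    by_cases hik1 : i = k + 1
    · subst hik1
      -- Hence `d' e_{k+1} = d' d' e_k = 0`.
      have h2 := sum_coeff_mul_coeff hdd k hj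
      rw [Finset.sum_eq_single ⟨k + 1, hk1s⟩] at h2
      · simpa [hk1] using h2
      · intro l _ hl
        rw [hrow l (fun h3 => hl (Fin.ext h3)), zero_mul]
      · simp
    have hcol : coeff d' i (k + 1) = 0 := by
      by_cases hlt : i < k
      · exact hleft i hlt
      · exact htri' _ _ (by omega)
    rcases h1 with h1 | h1 | rfl | rfl
    · exact absurd h1 hik
    · exact absurd h1 hik1
    -- Only the basis vector `e_k` has `e_{k+1}` in its differential, so `⟨d' d' e_i, e_{k+1}⟩ = 0`
    -- reduces to `⟨d' e_i, e_k⟩ = 0`.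
    · have h2 := sum_coeff_mul_coeff hdd i hk1s
      rw [Finset.sum_eq_single ⟨j, hks⟩] at h2
      · simpa [hk1] using h2
      · intro l _ hl
        by_cases hlt : (l : ℕ) < j
        · rw [hleft _ hlt, mul_zero]
        · rw [htri' l _ (by have : (l : ℕ) ≠ j := fun h3 => hl (Fin.ext h3)
                            omega), mul_zero]
      · simp
    · exact hcol

end Coefficients

/-! ### Sums over the left parts of admissible disks -/

namespace Front

variable {L : Front} {g i j k : ℕ} {q : Fin L.word.length}

theorem getElem?_of_get {t : Singularity} (h : L.word.get q = t) : L.word[(q : ℕ)]? = some t := by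
  rw [← h]
  simp

theorem strands_of_length_le (h : L.word.length ≤ g) : L.strands g = 0 := by
  have h1 := L.closed
  simpa [strands, strandCount, List.take_of_length_le h] using h1

theorem strands_succ {t : Singularity} (h : L.word[g]? = some t) :
    L.strands (g + 1) = t.strandsAfter (L.strands g) := by
  simp [strands, strandCount, List.take_add_one, h]

theorem fits_of_getElem? {t : Singularity} (h : L.word[g]? = some t) : t.Fits (L.strands g) := by
  obtain ⟨hg, rfl⟩ := List.getElem?_eq_some_iff.1 h
  exact L.fits g hg

theorem slab_eq (q : Fin L.word.length) : L.slab q = some q := by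
  simp [slab]

theorem slab_eq_some (h : L.slab g = some q) : g = q := by
  unfold slab at h
  split_ifs at h with h1
  exact congrArg Fin.val (Option.some.inj h)

/-- The chord sequences which record admissible disks. -/
noncomputable def diskSystem (L : Front) : ChordSystem L where
  strands := L.strands
  size := L.word.length
  strands_eq_zero _ := strands_of_length_le
  slab := L.slab
  step := L.DiskStep
  step_pos _ _ h := h.1
  terminal c := ∃ g k, L.word[g]? = some (.leftCusp k) ∧ c = ⟨g + 1, k, k + 1⟩
  final _ := []

/-- The sum of the words of the left parts of admissible disks which start with the chord `[i, j]`
over the line in gap `g`. -/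
noncomputable def diskSum (L : Front) (g i j : ℕ) : L.Alg := L.diskSystem.pathSum ⟨g, i, j⟩

theorem setOf_isAdmissibleDisk (a : L.Generator)
    (hk : L.word.get a.1 = .crossing k ∨ L.word.get a.1 = .rightCusp k) :
    {D | L.IsAdmissibleDisk a D} = L.diskSystem.pathsFrom ⟨a.1, k, k + 1⟩ := by
  ext D
  constructor
  · rintro ⟨h1, ⟨k', h2, h3⟩, h4, g, l, h5, h6⟩
    obtain rfl : k' = k := by
      rcases hk with hk | hk <;> rw [hk] at h2 <;> simpa [eq_comm] using h2
    exact ⟨h1, h3, h4, _, h6, g, l, h5, rfl⟩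
  · rintro ⟨h1, h2, h3, e, h4, g, l, h5, rfl⟩
    exact ⟨h1, ⟨k, hk, h2⟩, h3, g, l, h5, h4⟩

theorem diskWord_eq {c : Chord} {D : List Chord} (h : D ∈ L.diskSystem.pathsFrom c) :
    L.diskWord D = L.diskSystem.word D := by
  obtain ⟨-, -, -, e, h4, -⟩ := h
  exact L.diskSystem.cornerWord_eq_word h4

-- Summing over words the number of disks with that word amounts to summing over all disks
-- originating at `a`.
open Classical in
theorem ceGen_eq (a : L.Generator)
    (hk : L.word.get a.1 = .crossing k ∨ L.word.get a.1 = .rightCusp k) :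
    L.ceGen a = (if ∃ k, L.word.get a.1 = .rightCusp k then 1 else 0) +
      L.diskSum a.1 k (k + 1) := by
  rw [ceGen, diskSum, ChordSystem.pathSum,
    ← finsum_ncard_fiber (L.diskSystem.finite_pathsFrom _) L.diskSystem.word monomial]
  congr 1
  refine finsum_congr fun w => ?_
  congr 3
  rw [← setOf_isAdmissibleDisk a hk, disks]
  ext D
  refine and_congr_right fun h => ?_
  rw [diskWord_eq (c := ⟨a.1, k, k + 1⟩)]
  rw [← setOf_isAdmissibleDisk a hk]
  exact h

/-- The local forms of an admissible disk at a given singularity. -/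
def DiskStepAt (t : Singularity) (c c' : Chord) : Prop :=
  match t with
  | .crossing k => SmoothAt k c c' ∨ TopCornerAt k c c' ∨ BotCornerAt k c c'
  | .leftCusp k => c.top = shift k c'.top ∧ c.bot = shift k c'.bot
  | .rightCusp k => c'.top = shift k c.top ∧ c'.bot = shift k c.bot

theorem diskStep_iff {t : Singularity} (ht : L.word[g]? = some t) {c c' : Chord}
    (hc : c'.pos = g) : L.DiskStep c c' ↔ c.pos = c'.pos + 1 ∧ DiskStepAt t c c' := by
  unfold DiskStep
  rw [hc, ht]
  cases t <;> rfl

theorem diskSystem_terminal_iff {t : Singularity} (ht : L.word[g]? = some t) :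
    L.diskSystem.terminal ⟨g + 1, i, j⟩ ↔ t = .leftCusp i ∧ j = i + 1 := by
  simp only [diskSystem, Chord.mk.injEq, Nat.add_right_cancel_iff]
  constructor
  · rintro ⟨g', k, h1, rfl, rfl, rfl⟩
    rw [ht, Option.some.injEq] at h1
    exact ⟨h1, rfl⟩
  · rintro ⟨rfl, rfl⟩
    exact ⟨g, i, ht, rfl, rfl, rfl⟩

theorem diskSum_crossing (hk : L.word.get q = .crossing k) (hij : i < j)
    (hj : j < L.strands (q + 1)) :
    L.diskSum (q + 1) i j =
      crossStep k (FreeAlgebra.ι (ZMod 2) (crossingGen q hk)) (L.diskSum q) i j := by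
  have hq := getElem?_of_get hk
  unfold diskSum
  rw [L.diskSystem.pathSum_crossing (slab_eq q) hk (fun c c' hc => diskStep_iff hq hc) ⟨hij, hj⟩,
    if_neg, zero_add]
  rw [diskSystem_terminal_iff hq]
  simp

theorem not_crossing_of_slab {t : Singularity} (ht : L.word[g]? = some t)
    (h : ∀ k, t ≠ .crossing k) (q : Fin L.word.length) (hq : L.slab g = some q) (k : ℕ) :
    L.word.get q ≠ .crossing k := by
  intro hk
  have h1 := getElem?_of_get hk
  rw [← slab_eq_some hq, ht] at h1
  exact h k (Option.some.inj h1)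

/-- The disk must terminate here, with empty word: neither strand of the cusp continues to the left.
-/
theorem diskSum_leftCusp_self (hk : L.word[g]? = some (.leftCusp k)) :
    L.diskSum (g + 1) k (k + 1) = 1 := by
  have hf : k ≤ L.strands g := fits_of_getElem? hk
  have hs : L.strands (g + 1) = L.strands g + 2 := strands_succ hk
  unfold diskSum
  rw [L.diskSystem.pathSum_of_not_crossing (not_crossing_of_slab hk (by simp))
    ⟨Nat.lt_succ_self k, show k + 1 < L.strands (g + 1) by omega⟩ ∅, if_pos]
  · simp [diskSystem, monomial_nil]
  · rw [diskSystem_terminal_iff hk]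
    simp
  · intro a b
    have h1 : L.diskSystem.step ⟨g + 1, k, k + 1⟩ ⟨g, a, b⟩ ↔ _ := diskStep_iff hk rfl
    rw [h1]
    simp only [Finset.notMem_empty, iff_false]
    rintro ⟨-, h2, -⟩
    exact shift_ne_self k a h2.symm

theorem diskSum_leftCusp_shift (hk : L.word[g]? = some (.leftCusp k)) (hij : i < j)
    (hj : j < L.strands g) : L.diskSum (g + 1) (shift k i) (shift k j) = L.diskSum g i j := by
  have hf : k ≤ L.strands g := fits_of_getElem? hk
  have hs : L.strands (g + 1) = L.strands g + 2 := strands_succ hk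
  have hv : L.diskSystem.Valid ⟨g + 1, shift k i, shift k j⟩ := by
    refine ⟨shift_lt_shift.2 hij, ?_⟩
    change shift k j < L.strands (g + 1)
    rwa [hs, shift_lt hf]
  unfold diskSum
  rw [L.diskSystem.pathSum_of_not_crossing (not_crossing_of_slab hk (by simp)) hv {(i, j)}, if_neg]
  · simp
  · rw [diskSystem_terminal_iff hk, Singularity.leftCusp.injEq]
    exact fun h => shift_ne_self k i h.1.symm
  · intro a b
    have h1 : L.diskSystem.step ⟨g + 1, shift k i, shift k j⟩ ⟨g, a, b⟩ ↔ _ := diskStep_iff hk rfl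
    rw [h1]
    simp [DiskStepAt, (shift_injective k).eq_iff, eq_comm]

/-- The boundary of a disk cannot run into a left cusp unless the disk fills its inside and
terminates there. -/
theorem diskSum_leftCusp_of_eq (hk : L.word[g]? = some (.leftCusp k)) (hij : i < j)
    (hj : j < L.strands (g + 1)) (h : i ≠ k ∨ j ≠ k + 1)
    (h' : i = k ∨ i = k + 1 ∨ j = k ∨ j = k + 1) : L.diskSum (g + 1) i j = 0 := by
  unfold diskSum
  rw [L.diskSystem.pathSum_of_not_crossing (not_crossing_of_slab hk (by simp)) ⟨hij, hj⟩ ∅,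
    if_neg]
  · simp
  · rw [diskSystem_terminal_iff hk, Singularity.leftCusp.injEq]
    rintro ⟨rfl, rfl⟩
    simp at h
  · intro a b
    have h1 : L.diskSystem.step ⟨g + 1, i, j⟩ ⟨g, a, b⟩ ↔ _ := diskStep_iff hk rfl
    rw [h1]
    simp only [Finset.notMem_empty, iff_false]
    rintro ⟨-, rfl, rfl⟩
    rcases h' with h2 | h2 | h2 | h2
    exacts [shift_ne_self _ _ h2, shift_ne_succ _ _ h2, shift_ne_self _ _ h2, shift_ne_succ _ _ h2]

theorem diskSum_rightCusp (hk : L.word[g]? = some (.rightCusp k)) (hij : i < j)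
    (hj : j < L.strands (g + 1)) :
    L.diskSum (g + 1) i j = L.diskSum g (shift k i) (shift k j) := by
  unfold diskSum
  rw [L.diskSystem.pathSum_of_not_crossing (not_crossing_of_slab hk (by simp)) ⟨hij, hj⟩
    {(shift k i, shift k j)}, if_neg]
  · simp
  · rw [diskSystem_terminal_iff hk]
    simp
  · intro a b
    have h1 : L.diskSystem.step ⟨g + 1, i, j⟩ ⟨g, a, b⟩ ↔ _ := diskStep_iff hk rfl
    rw [h1]
    simp [DiskStepAt]

end Front

/-! ### Vertical lines of a marked front versus gaps of the front -/

namespace MarkedFront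

variable {L : Front} (H : MarkedFront L) {m m' : ℕ} {q : Fin L.word.length}

theorem gap_succ {t : Tangle L.word.length} (h : H.tangles[m]? = some t) :
    H.gap (m + 1) = H.gap m + t.sing?.toList.length := by
  cases t <;> simp [gap, List.take_add_one, h, Tangle.sing?]

theorem gap_succ_sing (h : H.tangles[m]? = some (.sing q)) : H.gap (m + 1) = H.gap m + 1 :=
  H.gap_succ h

theorem gap_succ_handleslide {k l : ℕ} (h : H.tangles[m]? = some (.handleslide k l)) :
    H.gap (m + 1) = H.gap m :=
  H.gap_succ h

theorem gap_mono (h : m ≤ m') : H.gap m ≤ H.gap m' :=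
  ((List.take_sublist_take_left h).filterMap _).length_le

/-- The singularities occur among the tangles in their order along the front, so exactly `q` of them
precede number `q`. -/
theorem gap_eq (h : H.tangles[m]? = some (.sing q)) : H.gap m = q := by
  obtain ⟨hm, hq⟩ := List.getElem?_eq_some_iff.1 h
  have h1 : (H.tangles.take m).filterMap Tangle.sing? ++
      q :: (H.tangles.drop (m + 1)).filterMap Tangle.sing? = List.finRange L.word.length := by
    rw [← H.sings]
    conv_rhs => rw [← List.take_append_drop m H.tangles, List.drop_eq_getElem_cons hm, hq]
    rw [List.filterMap_append, List.filterMap_cons]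
    rfl
  have h2 : (List.finRange L.word.length)[H.gap m]? = some q := by
    rw [← h1, gap, List.getElem?_append_right le_rfl]
    simp
  obtain ⟨h3, h4⟩ := List.getElem?_eq_some_iff.1 h2
  rw [← h4]
  simp

theorem gap_succ_eq (h : H.tangles[m]? = some (.sing q)) : H.gap (m + 1) = q + 1 := by
  rw [H.gap_succ_sing h, H.gap_eq h]

/-- The gap increases strictly across a singularity, so two occurrences would be at different gaps.
-/
theorem tangle_unique (h : H.tangles[m]? = some (.sing q)) (h' : H.tangles[m']? = some (.sing q)) :
    m = m' := by
  have key : ∀ {a b : ℕ}, H.tangles[a]? = some (Tangle.sing q) →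
      H.tangles[b]? = some (Tangle.sing q) → ¬ a < b := by
    intro a b ha hb hab
    have h1 := H.gap_mono (Nat.succ_le_of_lt hab)
    rw [H.gap_eq hb, Nat.succ_eq_add_one, H.gap_succ_eq ha] at h1
    omega
  exact le_antisymm (not_lt.1 (key h' h)) (not_lt.1 (key h h'))

theorem exists_tangle (q : Fin L.word.length) : ∃ m : ℕ, H.tangles[m]? = some (.sing q) := by
  have h : q ∈ H.tangles.filterMap Tangle.sing? := by
    rw [H.sings]
    exact List.mem_finRange q
  obtain ⟨t, h1, h2⟩ := List.mem_filterMap.1 h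
  cases t with
  | handleslide k l => simp [Tangle.sing?] at h2
  | sing q' =>
    obtain rfl : q' = q := by simpa [Tangle.sing?] using h2
    exact List.mem_iff_getElem?.1 h1

theorem exists_tangle_of_succ {t : Tangle L.word.length} (h : H.tangles[m + 1]? = some t) :
    ∃ t', H.tangles[m]? = some t' := by
  obtain ⟨hm, -⟩ := List.getElem?_eq_some_iff.1 h
  exact ⟨H.tangles[m], List.getElem?_eq_getElem (by omega)⟩

theorem slab_eq (h : H.tangles[m]? = some (.sing q)) : H.slab m = some q := by
  simp [slab, h, Tangle.sing?]

theorem slab_handleslide {k l : ℕ} (h : H.tangles[m]? = some (.handleslide k l)) :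
    H.slab m = none := by
  simp [slab, h, Tangle.sing?]

theorem strands_succ (h : H.tangles[m]? = some (.sing q)) {t : Singularity}
    (ht : L.word.get q = t) : H.strands (m + 1) = t.strandsAfter (H.strands m) := by
  rw [strands, H.gap_succ_eq h, Front.strands_succ (Front.getElem?_of_get ht), strands, H.gap_eq h]

theorem fits (h : H.tangles[m]? = some (.sing q)) {t : Singularity}
    (ht : L.word.get q = t) : t.Fits (H.strands m) := by
  rw [strands, H.gap_eq h]
  exact Front.fits_of_getElem? (Front.getElem?_of_get ht)

theorem strands_handleslide {k l : ℕ} (h : H.tangles[m]? = some (.handleslide k l)) :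
    H.strands (m + 1) = H.strands m := by
  rw [strands, H.gap_succ_handleslide h, strands]

theorem strands_eq_zero (h : H.tangles.length ≤ m) : H.strands m = 0 := by
  have h2 : H.gap m = L.word.length := by
    simp [gap, List.take_of_length_le h, H.sings]
  rw [strands, h2]
  exact Front.strands_of_length_le le_rfl

end MarkedFront

/-! ### Chord paths of an MCS and the degrees of their words -/

theorem Front.degree_crossing {L : Front} (μ : L.MaslovPotential) {a : L.Generator} {k : ℕ}
    (h : L.word.get a.1 = .crossing k) : degree μ a = μ.val a.1 k - μ.val a.1 (k + 1) := by
  simp only [degree, h]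

theorem Front.degree_rightCusp {L : Front} (μ : L.MaslovPotential) {a : L.Generator} {k : ℕ}
    (h : L.word.get a.1 = .rightCusp k) : degree μ a = 1 := by
  simp only [degree, h]

namespace MCS

variable {L : Front} {μ : L.MaslovPotential} (C : MCS L μ) {m i j k l : ℕ}
  {q : Fin L.word.length}

theorem coeff_eq_zero_of_le (h : j ≤ i) : coeff (C.d m) i j = 0 := by
  by_contra hn
  exact absurd (C.d_triangular m i j hn) (by omega)

theorem chordStep_crossing (h : C.tangles[m]? = some (.sing q)) (hk : L.word.get q = .crossing k)
    {c c' : Chord} (hc : c'.pos = m) : C.ChordStep c c' ↔ c.pos = c'.pos + 1 ∧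
      (SmoothAt k c c' ∨ TopCornerAt k c c' ∨ BotCornerAt k c c') := by
  unfold ChordStep
  rw [hc, h]
  dsimp only
  rw [hk]

theorem chordStep_leftCusp (h : C.tangles[m]? = some (.sing q)) (hk : L.word.get q = .leftCusp k)
    {c c' : Chord} (hc : c'.pos = m) : ¬ C.ChordStep c c' := by
  unfold ChordStep
  rw [hc, h]
  dsimp only
  rw [hk]
  exact fun h => h.2

theorem chordStep_rightCusp (h : C.tangles[m]? = some (.sing q))
    (hk : L.word.get q = .rightCusp k) {c c' : Chord} (hc : c'.pos = m) :
    C.ChordStep c c' ↔ c.pos = c'.pos + 1 ∧ (c'.top = shift k c.top ∧ c'.bot = shift k c.bot) := by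
  unfold ChordStep
  rw [hc, h]
  dsimp only
  rw [hk]

theorem chordStep_handleslide (h : C.tangles[m]? = some (.handleslide k l)) {c c' : Chord}
    (hc : c'.pos = m) : C.ChordStep c c' ↔ c.pos = c'.pos + 1 ∧
      ((c'.top = c.top ∧ c'.bot = c.bot) ∨
      (c.top = k ∧ l < c.bot ∧ c'.top = l ∧ c'.bot = c.bot) ∨
      (c.bot = l ∧ c.top < k ∧ c'.top = c.top ∧ c'.bot = k)) := by
  unfold ChordStep
  rw [hc, h]

/-- A chord path may terminate at the crossing `b` with the chord `c`. -/
def TerminatesAt (b : L.Generator) (c : Chord) : Prop :=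
  ∃ p k, C.tangles[p]? = some (.sing b.1) ∧ L.word.get b.1 = .crossing k ∧ c.pos = p + 1 ∧
    ((c.bot = k ∧ coeff (C.d p) c.top k = 1) ∨ (c.top = k + 1 ∧ coeff (C.d p) (k + 1) c.bot = 1))

theorem TerminatesAt.unique {C : MCS L μ} {b b' : L.Generator} {c : Chord}
    (h : C.TerminatesAt b c) (h' : C.TerminatesAt b' c) : b = b' := by
  obtain ⟨p, k, h1, -, h2, -⟩ := h
  obtain ⟨p', k', h1', -, h2', -⟩ := h'
  obtain rfl : p = p' := by omega
  rw [h1, Option.some.injEq, Tangle.sing.injEq] at h1'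
  exact Subtype.ext h1'

open Classical in
/-- The chord sequences which are chord paths with convex corners. -/
noncomputable def chordSystem : ChordSystem L where
  strands := C.strands
  size := C.tangles.length
  strands_eq_zero _ := C.strands_eq_zero
  slab := C.slab
  step := C.ChordStep
  step_pos _ _ h := h.1
  terminal c := ∃ b, C.TerminatesAt b c
  final c := if h : ∃ b, C.TerminatesAt b c then [h.choose] else []

theorem chordSystem_final {b : L.Generator} {c : Chord} (h : C.TerminatesAt b c) :
    C.chordSystem.final c = [b] := by
  have h' : ∃ b, C.TerminatesAt b c := ⟨b, h⟩
  unfold chordSystem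
  dsimp only
  rw [dif_pos h', h'.choose_spec.unique h]

/-- The sum of the words of the left parts of chord paths which start with the chord `[i, j]` over
the line number `m`. -/
noncomputable def chordSum (m i j : ℕ) : L.Alg := C.chordSystem.pathSum ⟨m, i, j⟩

/-- The degree of the word of a chord path which starts with the chord `c`. -/
def chordDegree (c : Chord) : ℤ :=
  μ.val (C.gap c.pos) c.top - μ.val (C.gap c.pos) c.bot - 1

theorem val_crossing (h : C.tangles[m]? = some (.sing q)) (hk : L.word.get q = .crossing k)
    (hi : i < C.strands (m + 1)) :
    μ.val (C.gap (m + 1)) i = μ.val q (Equiv.swap k (k + 1) i) := by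
  have h1 : k + 1 < L.strands q := Front.fits_of_getElem? (Front.getElem?_of_get hk)
  have h2 : C.strands (m + 1) = C.strands m := C.strands_succ h hk
  rw [h2, MarkedFront.strands, C.gap_eq h] at hi
  rw [C.gap_succ_eq h, ← μ.crossing q k (Front.getElem?_of_get hk) _ ((swap_succ_lt h1).2 hi),
    Equiv.swap_apply_self]

/-- The differential has degree `-1`. If `⟨d e_i, e_k⟩ = 1` to the left of the crossing, then
`μ(e_i) - 1 = μ(e_k)`, while the lower end `k` of the chord on the right lies on the strand numbered
`k + 1` on the left; the difference is the degree of the crossing. The other case is symmetric. -/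
theorem wordDegree_final {c : Chord} (hc : C.chordSystem.Valid c) (h : C.chordSystem.terminal c) :
    Front.wordDegree μ (C.chordSystem.final c) = C.chordDegree c := by
  obtain ⟨b, hb⟩ := h
  rw [C.chordSystem_final hb]
  obtain ⟨p, k, h1, h2, h3, h4⟩ := hb
  obtain ⟨x, i, j⟩ := c
  obtain ⟨hij, hj⟩ := hc
  dsimp only at h3 h4 hij hj
  subst h3
  have hj' : j < C.strands (p + 1) := hj
  simp only [chordDegree, C.val_crossing h1 h2 hj', C.val_crossing h1 h2 (hij.trans hj'),
    Front.wordDegree, List.map_cons, List.map_nil, List.sum_cons, List.sum_nil, add_zero,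
    Front.degree_crossing μ h2]
  rcases h4 with ⟨rfl, h4⟩ | ⟨rfl, h4⟩
  · have h5 := C.d_degree p i j (by rw [h4]; exact one_ne_zero)
    rw [C.gap_eq h1] at h5
    rw [Equiv.swap_apply_left, Equiv.swap_apply_of_ne_of_ne (by omega) (by omega), h5]
    ring
  · have h5 := C.d_degree p (k + 1) j (by rw [h4]; exact one_ne_zero)
    rw [C.gap_eq h1] at h5
    rw [Equiv.swap_apply_right, Equiv.swap_apply_of_ne_of_ne (by omega) (by omega), h5]
    ring

theorem not_crossing_of_slab (h : C.tangles[m]? = some (.sing q))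
    (hk : ∀ k, L.word.get q ≠ .crossing k) (q' : Fin L.word.length) (hq : C.slab m = some q')
    (k : ℕ) : L.word.get q' ≠ .crossing k := by
  rw [C.slab_eq h, Option.some.injEq] at hq
  rw [← hq]
  exact hk k

theorem not_crossing_of_slab_handleslide (h : C.tangles[m]? = some (.handleslide k l))
    (q : Fin L.word.length) (hq : C.slab m = some q) (k : ℕ) : L.word.get q ≠ .crossing k := by
  rw [C.slab_handleslide h] at hq
  exact absurd hq (by simp)

/-- Turning at a corner replaces one crossing strand by the other, which changes the potential
difference of the endpoints by the degree of the crossing. Jumps along marks do not change it, since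
a mark joins strands of equal potential. -/
theorem chordDegree_step {c c' : Chord} (hc : C.chordSystem.Valid c)
    (hc' : C.chordSystem.Valid c') (h : C.chordSystem.step c c') :
    Front.wordDegree μ (L.topCorner C.chordSystem.slab c c') + C.chordDegree c' +
      Front.wordDegree μ (L.botCorner C.chordSystem.slab c c') = C.chordDegree c := by
  classical
  have hstep : C.ChordStep c c' := h
  obtain ⟨x, i, j⟩ := c
  obtain ⟨m, i', j'⟩ := c'
  obtain ⟨hij, hj⟩ := hc
  obtain ⟨hij', hj'⟩ := hc'
  dsimp only at hij hj hij' hj'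
  obtain rfl : x = m + 1 := hstep.1
  have hj : j < C.strands (m + 1) := hj
  change Front.wordDegree μ (L.topCorner C.slab _ _) + _ +
    Front.wordDegree μ (L.botCorner C.slab _ _) = _
  rcases ht : C.tangles[m]? with _ | ⟨q⟩ | ⟨k, l⟩
  · have h2 := hstep.2
    simp [ht] at h2
  · rcases hk : L.word.get q with k | k | k
    · exact absurd hstep (C.chordStep_leftCusp ht hk rfl)
    · rw [Front.topCorner_crossing (C.slab_eq ht) hk, Front.botCorner_crossing (C.slab_eq ht) hk]
      have h2 := ((C.chordStep_crossing ht hk rfl).1 hstep).2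
      have hd : Front.wordDegree μ [Front.crossingGen q hk] = μ.val q k - μ.val q (k + 1) := by
        simp [Front.wordDegree, Front.degree_crossing μ (a := Front.crossingGen q hk) hk]
        rfl
      have h0 : Front.wordDegree μ ([] : List L.Generator) = 0 := rfl
      simp only [chordDegree, C.val_crossing ht hk hj, C.val_crossing ht hk (hij.trans hj),
        C.gap_eq ht]
      by_cases hT : TopCornerAt k ⟨m + 1, i, j⟩ ⟨m, i', j'⟩
      · have hB : ¬ BotCornerAt k ⟨m + 1, i, j⟩ ⟨m, i', j'⟩ := by
          have h3 := hT.1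
          dsimp only at h3
          rintro ⟨h4, -⟩
          dsimp only at h4
          omega
        rw [if_pos hT, if_neg hB, hd, h0]
        obtain ⟨rfl, rfl, rfl⟩ := hT
        rw [Equiv.swap_apply_right,
          Equiv.swap_apply_of_ne_of_ne (by dsimp only at *; omega) (by dsimp only at *; omega)]
        dsimp only
        ring
      · by_cases hB : BotCornerAt k ⟨m + 1, i, j⟩ ⟨m, i', j'⟩
        · rw [if_neg hT, if_pos hB, hd, h0]
          obtain ⟨rfl, h3, rfl⟩ := hB
          dsimp only at h3 ⊢
          subst h3
          rw [Equiv.swap_apply_left,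
            Equiv.swap_apply_of_ne_of_ne (by dsimp only at *; omega) (by dsimp only at *; omega)]
          ring
        · rw [if_neg hT, if_neg hB, h0]
          obtain ⟨-, rfl, rfl⟩ := h2.resolve_right (not_or.2 ⟨hT, hB⟩)
          ring
    · have hk' : ∀ l, L.word.get q ≠ .crossing l := fun l => by rw [hk]; simp
      rw [Front.topCorner_eq_nil (C.not_crossing_of_slab ht hk'),
        Front.botCorner_eq_nil (C.not_crossing_of_slab ht hk')]
      obtain ⟨-, rfl, rfl⟩ := (C.chordStep_rightCusp ht hk rfl).1 hstep
      have h3 := (μ.rightCusp q k (Front.getElem?_of_get hk)).1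
      rw [MarkedFront.strands, C.gap_succ_eq ht] at hj
      simp only [chordDegree, C.gap_eq ht, C.gap_succ_eq ht, h3 i (hij.trans hj), h3 j hj,
        Front.wordDegree, List.map_nil, List.sum_nil]
      ring
  · rw [Front.topCorner_eq_nil (C.not_crossing_of_slab_handleslide ht),
      Front.botCorner_eq_nil (C.not_crossing_of_slab_handleslide ht)]
    have h3 := (C.handleslide_mark m k l ht).2.2
    have h4 := ((C.chordStep_handleslide ht rfl).1 hstep).2
    simp only [chordDegree, C.gap_succ_handleslide ht, Front.wordDegree, List.map_nil,
      List.sum_nil]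
    rcases h4 with ⟨rfl, rfl⟩ | ⟨rfl, -, rfl, rfl⟩ | ⟨rfl, -, rfl, rfl⟩ <;> dsimp only <;>
      linarith

theorem mem_pathsFrom_iff {a : L.Generator} (hm : C.tangles[m]? = some (.sing a.1))
    (hk : L.word.get a.1 = .crossing k ∨ L.word.get a.1 = .rightCusp k) {Λ : List Chord} :
    Λ ∈ C.chordSystem.pathsFrom ⟨m, k, k + 1⟩ ↔ ∃ b, C.IsChordPath a b Λ := by
  constructor
  · rintro ⟨h1, h2, h3, ⟨x, i, j⟩, h4, b, p, l, h5, h6, h7, h8⟩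
    dsimp only at h7 h8
    subst h7
    refine ⟨b, h1, ⟨m, k, hm, hk, h2⟩, h3, p, l, h5, h6, ?_⟩
    rcases h8 with ⟨rfl, h8⟩ | ⟨rfl, h8⟩
    · exact Or.inl ⟨i, h4, h8⟩
    · exact Or.inr ⟨j, h4, h8⟩
  · rintro ⟨b, h1, ⟨m', k', h2, h3, h4⟩, h5, p, l, h6, h7, h8⟩
    obtain rfl : k' = k := by
      rcases hk with hk | hk <;> rw [hk] at h3 <;> simpa [eq_comm] using h3
    obtain rfl := C.tangle_unique hm h2
    refine ⟨h1, h4, h5, ?_⟩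
    rcases h8 with ⟨i, h8, h9⟩ | ⟨j, h8, h9⟩
    · exact ⟨_, h8, b, p, l, h6, h7, rfl, Or.inl ⟨rfl, h9⟩⟩
    · exact ⟨_, h8, b, p, l, h6, h7, rfl, Or.inr ⟨rfl, h9⟩⟩

theorem cornerWord_eq {a b : L.Generator} {Λ : List Chord} (h : C.IsChordPath a b Λ) :
    L.cornerWord C.slab [b] Λ = C.chordSystem.word Λ := by
  obtain ⟨-, -, -, p, k, h1, h2, h3⟩ := h
  have h4 : ∃ e, Λ.getLast? = some e ∧ C.TerminatesAt b e := by
    rcases h3 with ⟨i, h3, h4⟩ | ⟨j, h3, h4⟩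
    · exact ⟨_, h3, p, k, h1, h2, rfl, Or.inl ⟨rfl, h4⟩⟩
    · exact ⟨_, h3, p, k, h1, h2, rfl, Or.inr ⟨rfl, h4⟩⟩
  obtain ⟨e, h4, h5⟩ := h4
  rw [← C.chordSystem.cornerWord_eq_word h4, C.chordSystem_final h5]
  rfl

theorem length_cornerWord {L : Front} (slab : ℕ → Option (Fin L.word.length))
    (t : List L.Generator) (Λ : List Chord) : t.length ≤ (L.cornerWord slab t Λ).length := by
  induction Λ with
  | nil => rfl
  | cons c Λ ih =>
    cases Λ with
    | nil => rfl
    | cons c' Λ =>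
      rw [Front.cornerWord]
      simp only [List.length_append]
      omega

theorem mem_chordPaths_iff {a : L.Generator} (hm : C.tangles[m]? = some (.sing a.1))
    (hk : L.word.get a.1 = .crossing k ∨ L.word.get a.1 = .rightCusp k) {Λ : List Chord}
    {w : List L.Generator} : Λ ∈ C.chordPaths a w ↔
      Λ ∈ C.chordSystem.pathsFrom ⟨m, k, k + 1⟩ ∧ C.chordSystem.word Λ = w := by
  rw [C.mem_pathsFrom_iff hm hk]
  constructor
  · rintro ⟨b, h1, h2⟩
    exact ⟨⟨b, h1⟩, by rw [← C.cornerWord_eq h1, h2]⟩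
  · rintro ⟨⟨b, h1⟩, h2⟩
    exact ⟨b, h1, by rw [C.cornerWord_eq h1, h2]⟩

theorem chordDegree_generator {a : L.Generator} (hm : C.tangles[m]? = some (.sing a.1))
    (hk : L.word.get a.1 = .crossing k ∨ L.word.get a.1 = .rightCusp k) :
    C.chordDegree ⟨m, k, k + 1⟩ = Front.degree μ a - 1 := by
  rw [chordDegree, C.gap_eq hm]
  rcases hk with hk | hk
  · rw [Front.degree_crossing μ hk]
  · rw [Front.degree_rightCusp μ hk, (μ.rightCusp _ _ (Front.getElem?_of_get hk)).2]
    ring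

/-- Shows that the conditions on words in `diffGen` exclude no chord path, so the sum may be taken
over all words. -/
theorem length_and_degree_of_mem_chordPaths {a : L.Generator} {Λ : List Chord}
    {w : List L.Generator} (h : Λ ∈ C.chordPaths a w) :
    1 ≤ w.length ∧ Front.wordDegree μ w = Front.degree μ a - 1 := by
  obtain ⟨b, h1, h2⟩ := id h
  obtain ⟨m, k, hm, hk, -⟩ := h1.originates
  refine ⟨?_, ?_⟩
  · rw [← h2]
    exact length_cornerWord _ [b] _
  · obtain ⟨h3, h4⟩ := (C.mem_chordPaths_iff hm hk).1 h
    rw [← h4, ← C.chordDegree_generator hm hk]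
    exact C.chordSystem.wordDegree_word μ C.chordDegree (fun c => C.wordDegree_final)
      (fun c c' => C.chordDegree_step) h3

theorem diffGen_eq_finsum (a : L.Generator) :
    C.diffGen a = ∑ᶠ w : List L.Generator, ((C.chordPaths a w).ncard : ZMod 2) •
      Front.monomial w := by
  refine finsum_congr fun w => ?_
  by_cases h : 1 ≤ w.length ∧ Front.wordDegree μ w = Front.degree μ a - 1
  · rw [finsum_eq_if, if_pos h]
  · have h1 : C.chordPaths a w = ∅ := by
      ext Λ
      simp only [Set.mem_empty_iff_false, iff_false]
      exact fun h2 => h (C.length_and_degree_of_mem_chordPaths h2)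
    simp [h1]

theorem diffGen_eq {a : L.Generator} (hm : C.tangles[m]? = some (.sing a.1))
    (hk : L.word.get a.1 = .crossing k ∨ L.word.get a.1 = .rightCusp k) :
    C.diffGen a = C.chordSum m k (k + 1) := by
  rw [diffGen_eq_finsum, chordSum, ChordSystem.pathSum,
    ← finsum_ncard_fiber (C.chordSystem.finite_pathsFrom _) C.chordSystem.word Front.monomial]
  refine finsum_congr fun w => ?_
  congr 3
  ext Λ
  exact C.mem_chordPaths_iff hm hk

end MCS

/-! ### The operators of a crossing and of a handleslide mark -/

theorem crossStep_add {A : Type*} [Ring A] (k : ℕ) (x : A) (f f' : ℕ → ℕ → A) (i j : ℕ) :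
    crossStep k x (fun i j => f i j + f' i j) i j = crossStep k x f i j + crossStep k x f' i j := by
  simp only [crossStep, mul_add, add_mul]
  split_ifs <;> abel

theorem map_crossStep {A B : Type*} [Ring A] [Ring B] (φ : A →+* B) (k : ℕ) (x : A)
    (f : ℕ → ℕ → A) (i j : ℕ) :
    φ (crossStep k x f i j) = crossStep k (φ x) (fun i j => φ (f i j)) i j := by
  unfold crossStep
  split_ifs <;> simp

/-- The effect of a handleslide mark between the strands `k` and `l` on the sums over chord
sequences. -/
def slideStep {A : Type*} [Ring A] (k l : ℕ) (f : ℕ → ℕ → A) (i j : ℕ) : A :=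
  f i j + (if i = k ∧ l < j then f l j else 0) + (if j = l ∧ i < k then f i k else 0)

theorem slideStep_add {A : Type*} [Ring A] (k l : ℕ) (f f' : ℕ → ℕ → A) (i j : ℕ) :
    slideStep k l (fun i j => f i j + f' i j) i j = slideStep k l f i j + slideStep k l f' i j := by
  simp only [slideStep]
  split_ifs <;> abel

/-- A handleslide mark immediately to the left of a crossing, between the strands which cross. -/
theorem crossStep_slideStep {A : Type*} [Ring A] (k : ℕ) (x : A) (f : ℕ → ℕ → A) {i j : ℕ}
    (hij : i < j) :
    crossStep k x (slideStep k (k + 1) f) i j = crossStep k (x + 1) f i j := by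
  unfold crossStep slideStep
  by_cases h1 : i = k ∧ j = k + 1
  · obtain ⟨rfl, rfl⟩ := h1
    simp
  -- Following its strand, the upper endpoint reaches number `k`, from which the mark lets it jump
  -- to `k + 1`. This is where the top corner would arrive, and it accounts for the `1` in `x + 1`;
  -- the case `j = k` is the mirror image.
  by_cases h2 : i = k + 1
  · subst h2
    have e1 : Equiv.swap k (k + 1) j = j := Equiv.swap_apply_of_ne_of_ne (by omega) (by omega)
    have h3 : j ≠ k := by omega
    have h4 : j ≠ k + 1 := by omega
    simp [e1, h3, h4, hij, add_mul, add_assoc, add_comm]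
  by_cases h3 : j = k
  · subst h3
    have e1 : Equiv.swap j (j + 1) i = i := Equiv.swap_apply_of_ne_of_ne (by omega) (by omega)
    have h4 : i ≠ j := by omega
    simp only [e1, h2, h4, hij, mul_add, Equiv.swap_apply_left, false_and, if_false, true_and, if_true,
      mul_one, add_zero]
    simp
    abel
  -- Otherwise, to the left of the crossing, the chord has neither its top at `k` nor its bottom at
  -- `k + 1`, so it ignores the mark.
  · have h4 : Equiv.swap k (k + 1) i ≠ k := by
      rw [Ne, Equiv.swap_apply_eq_iff, Equiv.swap_apply_left]
      exact h2
    have h5 : Equiv.swap k (k + 1) j ≠ k + 1 := by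
      rw [Ne, Equiv.swap_apply_eq_iff, Equiv.swap_apply_right]
      exact h3
    simp [h1, h2, h3, h4, h5]

/-! ### Recursions for chord sums and coefficients of the MCS -/

namespace MCS

variable {L : Front} {μ : L.MaslovPotential} (C : MCS L μ) {m i j k l : ℕ}
  {q : Fin L.word.length}

/-- A coefficient of a differential, as an element of the algebra. -/
noncomputable def coeffAlg (m i j : ℕ) : L.Alg := algebraMap (ZMod 2) L.Alg (coeff (C.d m) i j)

/-- The sum of the words of the left parts of chord paths which start with the chord `[i, j]`, plus
the coefficient of the differential. -/
noncomputable def fullSum (m i j : ℕ) : L.Alg := C.chordSum m i j + C.coeffAlg m i j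

theorem coeff_crossing (h : C.tangles[m]? = some (.sing q)) (hk : L.word.get q = .crossing k)
    (hi : i < C.strands (m + 1)) (hj : j < C.strands (m + 1)) :
    coeff (C.d (m + 1)) i j =
      coeff (C.d m) (Equiv.swap k (k + 1) i) (Equiv.swap k (k + 1) j) := by
  have hs : C.strands (m + 1) = C.strands m := C.strands_succ h hk
  have hf : k + 1 < C.strands m := C.fits h hk
  have h1 := coeff_eq_of_indexMap (Equiv.swap k (k + 1)).injective (C.crossing m q k h hk).2
    (i := Equiv.swap k (k + 1) i) (j := Equiv.swap k (k + 1) j)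
    ((swap_succ_lt hf).2 (hs ▸ hi)) ((swap_succ_lt hf).2 (hs ▸ hj))
    (by rwa [Equiv.swap_apply_self])
  rwa [Equiv.swap_apply_self, Equiv.swap_apply_self] at h1

theorem ite_coeff (a : ZMod 2) (x : L.Alg) :
    (if a = 1 then x else 0) = x * algebraMap (ZMod 2) L.Alg a := by
  have h : a = 0 ∨ a = 1 := by
    revert a
    decide
  rcases h with rfl | rfl <;> simp

theorem chordSystem_terminal_iff (h : C.tangles[m]? = some (.sing q))
    (hk : L.word.get q = .crossing k) : C.chordSystem.terminal ⟨m + 1, i, j⟩ ↔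
      (j = k ∧ coeff (C.d m) i k = 1) ∨ (i = k + 1 ∧ coeff (C.d m) (k + 1) j = 1) := by
  constructor
  · rintro ⟨b, p, k', h1, h2, h3, h4⟩
    dsimp only at h3 h4
    obtain rfl : m = p := by omega
    rw [h, Option.some.injEq, Tangle.sing.injEq] at h1
    subst h1
    rw [hk, Singularity.crossing.injEq] at h2
    rwa [h2]
  · exact fun h1 => ⟨Front.crossingGen q hk, m, k, h, hk, rfl, h1⟩

theorem not_terminal (h : ∀ q, C.tangles[m]? = some (.sing q) → ∀ k, L.word.get q ≠ .crossing k) :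
    ¬ C.chordSystem.terminal ⟨m + 1, i, j⟩ := by
  rintro ⟨b, p, k, h1, h2, h3, -⟩
  dsimp only at h3
  obtain rfl : m = p := by omega
  exact h _ h1 k h2

-- The first two summands are the paths terminating at this crossing. Over `ℤ/2` the condition that
-- a coefficient equals `1` is the same as multiplication by that coefficient.
open Classical in
theorem chordSum_crossing (h : C.tangles[m]? = some (.sing q)) (hk : L.word.get q = .crossing k)
    (hij : i < j) (hj : j < C.strands (m + 1)) :
    C.chordSum (m + 1) i j =
      (if i = k + 1 then FreeAlgebra.ι (ZMod 2) (Front.crossingGen q hk) * C.coeffAlg m (k + 1) j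
        else 0) +
      (if j = k then C.coeffAlg m i k * FreeAlgebra.ι (ZMod 2) (Front.crossingGen q hk) else 0) +
      crossStep k (FreeAlgebra.ι (ZMod 2) (Front.crossingGen q hk)) (C.chordSum m) i j := by
  unfold chordSum
  rw [C.chordSystem.pathSum_crossing (C.slab_eq h) hk
    (fun c c' hc => C.chordStep_crossing h hk hc) ⟨hij, hj⟩]
  congr 1
  have hfin : C.chordSystem.terminal ⟨m + 1, i, j⟩ →
      C.chordSystem.final ⟨m + 1, i, j⟩ = [Front.crossingGen q hk] := fun hs =>
    C.chordSystem_final ⟨m, k, h, hk, rfl, (C.chordSystem_terminal_iff h hk).1 hs⟩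
  have hval : (if C.chordSystem.terminal ⟨m + 1, i, j⟩ then
      Front.monomial (C.chordSystem.final ⟨m + 1, i, j⟩) else 0) =
      if C.chordSystem.terminal ⟨m + 1, i, j⟩ then
        FreeAlgebra.ι (ZMod 2) (Front.crossingGen q hk) else 0 := by
    split_ifs with hs
    · rw [hfin hs, Front.monomial_singleton]
    · rfl
  rw [hval]
  simp only [C.chordSystem_terminal_iff h hk, coeffAlg, ← ite_coeff]
  by_cases h2 : i = k + 1
  · have h3 : j ≠ k := by omega
    simp [h2, h3]
  · simp only [h2, false_and, or_false, if_false, zero_add]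
    rw [ite_and, ite_coeff, Algebra.commutes]

/-- Adding the coefficients makes the recursion homogeneous: the terminating paths are the corner
terms of the coefficient part, and conjugation by the transposition gives its smooth term. The chord
`[k, k + 1]`, excluded from the smooth term, has coefficient `0` by triangularity. -/
theorem fullSum_crossing (h : C.tangles[m]? = some (.sing q)) (hk : L.word.get q = .crossing k)
    (hij : i < j) (hj : j < C.strands (m + 1)) :
    C.fullSum (m + 1) i j =
      crossStep k (FreeAlgebra.ι (ZMod 2) (Front.crossingGen q hk)) (C.fullSum m) i j := by
  have h1 : C.coeffAlg (m + 1) i j = if i = k ∧ j = k + 1 then 0 else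
      C.coeffAlg m (Equiv.swap k (k + 1) i) (Equiv.swap k (k + 1) j) := by
    rw [coeffAlg, C.coeff_crossing h hk (hij.trans hj) hj]
    split_ifs with h2
    · obtain ⟨rfl, rfl⟩ := h2
      rw [Equiv.swap_apply_left, Equiv.swap_apply_right, C.coeff_eq_zero_of_le (Nat.le_succ _),
        map_zero]
    · rfl
  unfold fullSum
  rw [crossStep_add, C.chordSum_crossing h hk hij hj, h1]
  simp only [crossStep]
  abel

open Classical in
theorem chordSum_handleslide (h : C.tangles[m]? = some (.handleslide k l))
    (hij : i < j) (hj : j < C.strands (m + 1)) :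
    C.chordSum (m + 1) i j = slideStep k l (C.chordSum m) i j := by
  have hkl := (C.handleslide_mark m k l h).1
  have hn : ¬ C.chordSystem.terminal ⟨m + 1, i, j⟩ := C.not_terminal (by simp [h])
  have hst : ∀ a b, C.chordSystem.step ⟨m + 1, i, j⟩ ⟨m, a, b⟩ ↔ _ :=
    fun a b => C.chordStep_handleslide h rfl
  unfold chordSum slideStep
  by_cases h1 : i = k ∧ l < j
  · rw [C.chordSystem.pathSum_of_not_crossing (C.not_crossing_of_slab_handleslide h) ⟨hij, hj⟩
      {(i, j), (l, j)}, if_neg hn, Finset.sum_pair (by simp; omega), if_pos h1,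
      if_neg (by omega), zero_add, add_zero]
    intro a b
    rw [hst]
    simp only [Finset.mem_insert, Finset.mem_singleton, Prod.mk.injEq, true_and]
    omega
  by_cases h2 : j = l ∧ i < k
  · rw [C.chordSystem.pathSum_of_not_crossing (C.not_crossing_of_slab_handleslide h) ⟨hij, hj⟩
      {(i, j), (i, k)}, if_neg hn, Finset.sum_pair (by simp; omega), if_neg h1,
      if_pos h2, zero_add, add_zero]
    intro a b
    rw [hst]
    simp only [Finset.mem_insert, Finset.mem_singleton, Prod.mk.injEq, true_and]
    omega
  · rw [C.chordSystem.pathSum_of_not_crossing (C.not_crossing_of_slab_handleslide h) ⟨hij, hj⟩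
      {(i, j)}, if_neg hn, Finset.sum_singleton, if_neg h1, if_neg h2, zero_add, add_zero,
      add_zero]
    intro a b
    rw [hst]
    simp only [Finset.mem_singleton, Prod.mk.injEq, true_and]
    omega

theorem fullSum_handleslide (h : C.tangles[m]? = some (.handleslide k l))
    (hij : i < j) (hj : j < C.strands (m + 1)) :
    C.fullSum (m + 1) i j = slideStep k l (C.fullSum m) i j := by
  obtain ⟨hkl, hl, -⟩ := C.handleslide_mark m k l h
  have hs := C.strands_handleslide h
  have hcoeff : ∀ {i j}, i < C.strands m → j < C.strands m → _ :=
    fun {i j} hi hj => coeff_handleslide (i := i) (j := j) (C.handleslide m k l h) hs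
      (hkl.trans hl) hi hj
  have hj' : j < C.strands m := hs ▸ hj
  have h1 := hcoeff (hij.trans hj') hj'
  -- Row `l` is unchanged by the handleslide, since `⟨d e_l, e_k⟩ = 0` by triangularity; this turns
  -- the primed term in `h1` into an old coefficient.
  have h2 := hcoeff hl hj'
  rw [if_neg hkl.ne', add_zero] at h2
  rw [C.coeff_eq_zero_of_le hkl.le, ite_self, add_zero] at h2
  rw [← h2] at h1
  have h3 : coeff (C.d (m + 1)) i j = slideStep k l (coeff (C.d m)) i j := by
    -- Triangularity supplies the order conditions `l < j` and `i < k` that are imposed on chord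
    -- jumps.
    have h4 : (if i = k then coeff (C.d m) l j else 0) =
        if i = k ∧ l < j then coeff (C.d m) l j else 0 := by
      by_cases hlj : l < j
      · simp [hlj]
      · simp [hlj, C.coeff_eq_zero_of_le (not_lt.1 hlj)]
    have h5 : (if j = l then coeff (C.d m) i k else 0) =
        if j = l ∧ i < k then coeff (C.d m) i k else 0 := by
      by_cases hik : i < k
      · simp [hik]
      · simp [hik, C.coeff_eq_zero_of_le (not_lt.1 hik)]
    rw [h4, h5] at h1
    unfold slideStep
    rw [add_right_comm, h1, add_assoc, zmod_two_add_self, add_zero]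
  unfold fullSum
  rw [slideStep_add, C.chordSum_handleslide h hij hj]
  congr 1
  rw [coeffAlg, h3]
  unfold slideStep coeffAlg
  split_ifs <;> simp

theorem chordSum_leftCusp (h : C.tangles[m]? = some (.sing q)) (hk : L.word.get q = .leftCusp k)
    (hij : i < j) (hj : j < C.strands (m + 1)) : C.chordSum (m + 1) i j = 0 := by
  have hk' : ∀ l, L.word.get q ≠ .crossing l := fun l => by rw [hk]; simp
  unfold chordSum
  rw [C.chordSystem.pathSum_of_not_crossing (C.not_crossing_of_slab h hk') ⟨hij, hj⟩ ∅, if_neg]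
  · simp
  · refine C.not_terminal fun q' h1 => ?_
    rw [h, Option.some.injEq, Tangle.sing.injEq] at h1
    rwa [← h1]
  · intro a b
    simp only [Finset.notMem_empty, iff_false]
    exact C.chordStep_leftCusp h hk rfl

theorem chordSum_rightCusp (h : C.tangles[m]? = some (.sing q)) (hk : L.word.get q = .rightCusp k)
    (hij : i < j) (hj : j < C.strands (m + 1)) :
    C.chordSum (m + 1) i j = C.chordSum m (shift k i) (shift k j) := by
  have hk' : ∀ l, L.word.get q ≠ .crossing l := fun l => by rw [hk]; simp
  unfold chordSum
  rw [C.chordSystem.pathSum_of_not_crossing (C.not_crossing_of_slab h hk') ⟨hij, hj⟩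
    {(shift k i, shift k j)}, if_neg]
  · simp
  · refine C.not_terminal fun q' h1 => ?_
    rw [h, Option.some.injEq, Tangle.sing.injEq] at h1
    rwa [← h1]
  · intro a b
    have h1 : C.chordSystem.step ⟨m + 1, i, j⟩ ⟨m, a, b⟩ ↔ _ := C.chordStep_rightCusp h hk rfl
    rw [h1]
    simp

/-- The zigzag correction of `coeff_cusp` can be nonzero only if the chord passes across the two
cusp strands. As `i` and `k` are even, the pair `i`, `i + 1` lies entirely above or entirely below
the cusp. -/
theorem fullSum_rightCusp (h : C.tangles[m]? = some (.sing q)) (hk : L.word.get q = .rightCusp k)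
    (hke : Even k) (hi : Even i) (hj : i + 1 < C.strands (m + 1)) :
    C.fullSum (m + 1) i (i + 1) = C.fullSum m (shift k i) (shift k (i + 1)) := by
  have hs : C.strands (m + 1) = C.strands m - 2 := C.strands_succ h hk
  have hf : k + 1 < C.strands m := C.fits h hk
  obtain ⟨h1, h2⟩ := C.rightCusp m q k h hk
  have h3 := coeff_cusp h2 (C.coeff_eq_zero_of_le le_rfl) h1
    (show C.strands m = C.strands (m + 1) + 2 by omega)
    (show k ≤ C.strands (m + 1) by omega) (show i < C.strands (m + 1) by omega) hj
  have h4 : coeff (C.d m) (shift k i) (k + 1) * coeff (C.d m) k (shift k (i + 1)) = 0 := by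
    by_cases hik : i < k
    · have h5 : i + 1 < k := by
        rcases hke with ⟨a, rfl⟩
        rcases hi with ⟨b, rfl⟩
        omega
      rw [shift_of_lt h5, C.coeff_eq_zero_of_le h5.le, mul_zero]
    · rw [shift_of_le (not_lt.1 hik), C.coeff_eq_zero_of_le (by omega), zero_mul]
  rw [h4, add_zero] at h3
  rw [fullSum, C.chordSum_rightCusp h hk (Nat.lt_succ_self i) hj, coeffAlg, h3]
  rfl

end MCS

/-! ### Comparison of chord sums with disk sums on a nearly plat front -/

/-- The position of a kind of singularity in a nearly plat front: left cusps come before crossings,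
which come before right cusps. -/
def Singularity.rank : Singularity → ℕ
  | .leftCusp _ => 0
  | .crossing _ => 1
  | .rightCusp _ => 2

namespace Front

variable {L : Front}

theorem IsNearlyPlat.rank_le (hL : L.IsNearlyPlat) {g g' : ℕ} {t t' : Singularity} (hg : g < g')
    (h : L.word[g]? = some t) (h' : L.word[g']? = some t') : t.rank ≤ t'.rank := by
  obtain ⟨l, c, r, hw, -, -⟩ := hL
  have hp : L.word.Pairwise fun t t' => t.rank ≤ t'.rank := by
    rw [hw, List.pairwise_append, List.pairwise_append]
    simp only [List.pairwise_map, Singularity.rank, List.mem_append, List.mem_map]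
    refine ⟨⟨List.pairwise_of_forall fun _ _ => le_rfl,
      List.pairwise_of_forall fun _ _ => le_rfl, ?_⟩,
      List.pairwise_of_forall fun _ _ => le_rfl, ?_⟩
    · rintro _ ⟨a, -, rfl⟩ _ ⟨b, -, rfl⟩
      simp
    · rintro _ (⟨a, -, rfl⟩ | ⟨a, -, rfl⟩) _ ⟨b, -, rfl⟩ <;> simp
  obtain ⟨h1, rfl⟩ := List.getElem?_eq_some_iff.1 h
  obtain ⟨h2, rfl⟩ := List.getElem?_eq_some_iff.1 h'
  exact List.pairwise_iff_getElem.1 hp g g' h1 h2 hg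

theorem IsNearlyPlat.even_of_rightCusp (hL : L.IsNearlyPlat) {g k : ℕ}
    (h : L.word[g]? = some (.rightCusp k)) : Even k := by
  obtain ⟨l, c, r, hw, -, hr⟩ := hL
  have h1 := List.mem_of_getElem? h
  rw [hw] at h1
  simp only [List.mem_append, List.mem_map, reduceCtorEq, and_false, exists_false,
    Singularity.rightCusp.injEq, exists_eq_right, false_or] at h1
  exact hr k h1

theorem phiHom_ι (ε : L.Alg →ₐ[ZMod 2] ZMod 2) (q : L.Generator) :
    phiHom ε (FreeAlgebra.ι (ZMod 2) q) =
      FreeAlgebra.ι (ZMod 2) q + algebraMap (ZMod 2) L.Alg (ε (FreeAlgebra.ι (ZMod 2) q)) :=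
  FreeAlgebra.lift_ι_apply _ _

theorem phiHom_phiHom (ε : L.Alg →ₐ[ZMod 2] ZMod 2) (x : L.Alg) : phiHom ε (phiHom ε x) = x :=
  congrArg (fun F => F x) (phiHom_comp_self ε)

end Front

theorem leibnizExt_algebraMap {Q : Type} (f : Q → FreeAlgebra (ZMod 2) Q) (r : ZMod 2) :
    leibnizExt f (algebraMap (ZMod 2) _ r) = 0 := by
  change (leibnizHom f (algebraMap (ZMod 2) _ r)).snd = 0
  rw [AlgHom.commutes]
  rfl

/-- `crossStep` evaluates its argument only at genuine chords: the transposition reverses the order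
of the pair `k`, `k + 1` alone, and that pair is excluded. -/
theorem crossStep_congr {A : Type*} [Ring A] {k s : ℕ} (x : A) {f f' : ℕ → ℕ → A} (hk : k + 1 < s)
    (h : ∀ i j, i < j → j < s → f i j = f' i j) {i j : ℕ} (hij : i < j) (hj : j < s) :
    crossStep k x f i j = crossStep k x f' i j := by
  unfold crossStep
  refine congrArg₂ _ (congrArg₂ _ ?_ ?_) ?_
  · by_cases h1 : i = k ∧ j = k + 1
    · rw [if_pos h1, if_pos h1]
    · rw [if_neg h1, if_neg h1]
      refine h _ _ ?_ ((swap_succ_lt hk).2 hj)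
      rw [Equiv.swap_apply_def, Equiv.swap_apply_def]
      split_ifs <;> omega
  · by_cases h1 : i = k + 1
    · rw [if_pos h1, if_pos h1, h _ _ (h1 ▸ hij) hj]
    · rw [if_neg h1, if_neg h1]
  · by_cases h1 : j = k
    · rw [if_pos h1, if_pos h1, h _ _ (h1 ▸ hij) (by omega)]
    · rw [if_neg h1, if_neg h1]

namespace MCS

variable {L : Front} {μ : L.MaslovPotential} (C : MCS L μ) {m n i j k l : ℕ}
  {q : Fin L.word.length}

/-- The vertical line number `m` is not immediately to the right of a handleslide mark. -/
def Settled (m : ℕ) : Prop := ∀ n k l, n + 1 = m → C.tangles[n]? ≠ some (.handleslide k l)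

open Classical in
theorem augmentation_ι (q : L.Generator) :
    C.augmentation (FreeAlgebra.ι (ZMod 2) q) = if C.IsMarked q then 1 else 0 :=
  FreeAlgebra.lift_ι_apply _ _

theorem phiHom_ι_of_isMarked {q : L.Generator} (h : C.IsMarked q) :
    Front.phiHom C.augmentation (FreeAlgebra.ι (ZMod 2) q) = FreeAlgebra.ι (ZMod 2) q + 1 := by
  rw [Front.phiHom_ι, augmentation_ι, if_pos h, map_one]

theorem phiHom_ι_of_not_isMarked {q : L.Generator} (h : ¬ C.IsMarked q) :
    Front.phiHom C.augmentation (FreeAlgebra.ι (ZMod 2) q) = FreeAlgebra.ι (ZMod 2) q := by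
  rw [Front.phiHom_ι, augmentation_ι, if_neg h, map_zero, add_zero]

theorem not_isMarked_of_settled {q : L.Generator} (h : C.tangles[m]? = some (.sing q.1))
    (hm : C.Settled m) : ¬ C.IsMarked q := by
  rintro ⟨-, n, k, l, h1, h2⟩
  exact hm n k l (C.tangle_unique h2 h) h1

variable {C}

theorem IsAForm.settled (hC : C.IsAForm) (h : C.tangles[m]? = some (.sing q))
    (hq : ∀ k, L.word.get q ≠ .crossing k) : C.Settled m := by
  rintro n k l rfl h1
  obtain ⟨-, q', h2, h3⟩ := hC.2 n k l h1
  rw [h, Option.some.injEq, Tangle.sing.injEq] at h2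
  exact hq k (h2 ▸ h3)

theorem IsAForm.settled_of_handleslide (hC : C.IsAForm)
    (h : C.tangles[m]? = some (.handleslide k l)) : C.Settled m := by
  rintro n k' l' rfl h1
  obtain ⟨-, q', h2, -⟩ := hC.2 n k' l' h1
  rw [h] at h2
  simp at h2

theorem IsAForm.handleslide_of_crossing (hC : C.IsAForm)
    (h : C.tangles[m + 1]? = some (.sing q)) (hk : L.word.get q = .crossing k) {k' : ℕ}
    (h' : C.tangles[m]? = some (.handleslide k' l)) :
    C.tangles[m]? = some (.handleslide k (k + 1)) := by
  obtain ⟨rfl, q', h2, h3⟩ := hC.2 m k' l h'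
  rw [h, Option.some.injEq, Tangle.sing.injEq] at h2
  rw [← h2, hk, Singularity.crossing.injEq] at h3
  rw [h', h3]

/-- To the left of a left cusp there are only left cusps, and a chord path neither crosses nor
terminates at one. -/
theorem IsAForm.chordSum_eq_zero_of_leftCusp (hC : C.IsAForm) (hL : L.IsNearlyPlat)
    (h : C.tangles[m]? = some (.sing q)) (hk : L.word.get q = .leftCusp k) (hij : i < j)
    (hj : j < C.strands m) : C.chordSum m i j = 0 := by
  cases m with
  -- No strand lies over line number `0`.
  | zero => exact absurd hj (Nat.not_lt_zero _)
  | succ n =>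
    obtain ⟨t, ht⟩ := C.exists_tangle_of_succ h
    cases t with
    | handleslide k' l' =>
      exact absurd ht (hC.settled h (fun l => by rw [hk]; simp) n k' l' rfl)
    | sing q' =>
      have h1 : (q' : ℕ) < q := by
        have h2 := C.gap_succ_eq ht
        rw [C.gap_eq h] at h2
        omega
      rcases hk' : L.word.get q' with k' | k' | k'
      · exact C.chordSum_leftCusp ht hk' hij hj
      all_goals
        have h2 := hL.rank_le h1 (Front.getElem?_of_get hk') (Front.getElem?_of_get hk)
        simp [Singularity.rank] at h2

/-- To the left of all right cusps, the sums over chord paths together with the differentials of the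
Morse complex sequence are the sums over disks, in the twisted generators. -/
theorem IsAForm.fullSum_eq (hC : C.IsAForm) (hL : L.IsNearlyPlat) (m : ℕ) (hm : C.Settled m)
    (hr : ∀ g k, g < C.gap m → L.word[g]? ≠ some (.rightCusp k)) (i j : ℕ) (hij : i < j)
    (hj : j < C.strands m) :
    C.fullSum m i j = Front.phiHom C.augmentation (L.diskSum (C.gap m) i j) := by
  -- Strong induction is needed because a marked crossing is passed together with its mark, two
  -- lines at once.
  induction m using Nat.strong_induction_on generalizing i j with
  | _ m ih =>
  cases m with
  | zero => exact absurd hj (Nat.not_lt_zero _)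
  | succ m =>
  rcases ht : C.tangles[m]? with _ | ⟨q⟩ | ⟨k, l⟩
  · rw [C.strands_eq_zero (Nat.le_succ_of_le (List.getElem?_eq_none_iff.1 ht))] at hj
    exact absurd hj (Nat.not_lt_zero _)
  · have hgap := C.gap_eq ht
    have hgap' := C.gap_succ_eq ht
    rcases hk : L.word.get q with k | k | k
    · have hq := Front.getElem?_of_get hk
      have hs : C.strands (m + 1) = C.strands m + 2 := C.strands_succ ht hk
      have hf : k ≤ C.strands m := C.fits ht hk
      obtain ⟨h1, h2⟩ := C.leftCusp m q k ht hk
      obtain ⟨h3, h4⟩ := coeff_simple_leftCusp h2 (C.d_comp_d _) (C.d_triangular _) h1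
        (hC.1 m q k ht hk).1 (hC.1 m q k ht hk).2 hs hf
      rw [fullSum, C.chordSum_leftCusp ht hk hij hj, zero_add, coeffAlg, hgap']
      by_cases h5 : i = k ∧ j = k + 1
      · obtain ⟨rfl, rfl⟩ := h5
        rw [h1, Front.diskSum_leftCusp_self hq, map_one, map_one]
      by_cases h6 : i = k ∨ i = k + 1 ∨ j = k ∨ j = k + 1
      · have h5 := not_and_or.1 h5
        rw [h4 i j (hij.trans hj) hj h5 h6, map_zero, Front.diskSum_leftCusp_of_eq hq hij
          (by rwa [MarkedFront.strands, hgap'] at hj) h5 h6, map_zero]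
      · simp only [not_or] at h6
        obtain ⟨i, rfl⟩ := exists_shift_eq h6.1 h6.2.1
        obtain ⟨j, rfl⟩ := exists_shift_eq h6.2.2.1 h6.2.2.2
        rw [shift_lt_shift] at hij
        rw [hs, shift_lt hf] at hj
        have h7 := ih m (Nat.lt_succ_self m) (hC.settled ht (fun l => by rw [hk]; simp))
          (fun g k' hg => hr g k' (by omega)) i j hij hj
        -- There are no chord paths here yet, so the induction hypothesis speaks of the coefficient
        -- alone.
        rw [fullSum, hC.chordSum_eq_zero_of_leftCusp hL ht hk hij hj, zero_add, coeffAlg, hgap] at h7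
        rw [h3 i j (hij.trans hj) hj, h7, Front.diskSum_leftCusp_shift hq hij
          (by rwa [MarkedFront.strands, hgap] at hj)]
    · have hs : C.strands (m + 1) = C.strands m := C.strands_succ ht hk
      have hf : k + 1 < C.strands m := C.fits ht hk
      rw [C.fullSum_crossing ht hk hij hj, hgap', Front.diskSum_crossing hk hij
        (by rwa [MarkedFront.strands, hgap'] at hj), ← RingHom.coe_coe, map_crossStep,
        RingHom.coe_coe]
      rw [hs] at hj
      by_cases hm' : C.Settled m
      · rw [C.phiHom_ι_of_not_isMarked (C.not_isMarked_of_settled (q := Front.crossingGen q hk)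
          ht hm')]
        refine crossStep_congr _ hf (fun a b hab hb => ?_) hij hj
        rw [ih m (Nat.lt_succ_self m) hm' (fun g k' hg => hr g k' (by omega)) a b hab hb, hgap]
      -- The crossing is marked: its mark and the crossing together act as a crossing of weight `q +
      -- 1`, which is the image of `q` under `φ^ε`.
      · simp only [Settled, not_forall, not_not] at hm'
        obtain ⟨n, k', l, rfl, hn⟩ := hm'
        have hn := hC.handleslide_of_crossing ht hk hn
        have hgn := C.gap_succ_handleslide hn
        have hsn := C.strands_handleslide hn
        rw [C.phiHom_ι_of_isMarked (q := Front.crossingGen q hk)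
          ⟨⟨k, hk⟩, n, k, k + 1, hn, ht⟩, crossStep_congr _ hf
          (fun a b hab hb => C.fullSum_handleslide hn hab hb) hij hj,
          crossStep_slideStep _ _ _ hij]
        refine crossStep_congr _ hf (fun a b hab hb => ?_) hij hj
        rw [ih n (by omega) (hC.settled_of_handleslide hn) (fun g k' hg => hr g k' (by omega)) a b
          hab (hsn ▸ hb), ← hgn, hgap]
    · exact absurd (Front.getElem?_of_get hk) (hr q k (by omega))
  · exact absurd ht (hm m k l rfl)

/-- Among the right cusps this remains true for the pairs of strands which may meet in a right
cusp. -/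
theorem IsAForm.fullSum_pair_eq (hC : C.IsAForm) (hL : L.IsNearlyPlat) (m : ℕ) (hm : C.Settled m)
    (i : ℕ) (hi : Even i) (hj : i + 1 < C.strands m) :
    C.fullSum m i (i + 1) = Front.phiHom C.augmentation (L.diskSum (C.gap m) i (i + 1)) := by
  induction m generalizing i with
  | zero => exact absurd hj (Nat.not_lt_zero _)
  | succ m ih =>
    by_cases hr : ∀ g k, g < C.gap (m + 1) → L.word[g]? ≠ some (.rightCusp k)
    · exact hC.fullSum_eq hL (m + 1) hm hr _ _ (Nat.lt_succ_self i) hj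
    simp only [not_forall, not_not] at hr
    obtain ⟨g, k₀, hg, hr⟩ := hr
    rcases ht : C.tangles[m]? with _ | ⟨q⟩ | ⟨k, l⟩
    · rw [C.strands_eq_zero (Nat.le_succ_of_le (List.getElem?_eq_none_iff.1 ht))] at hj
      exact absurd hj (Nat.not_lt_zero _)
    · have hgap' := C.gap_succ_eq ht
      -- Some singularity to the left is a right cusp, so the last one before this line is a right
      -- cusp too.
      obtain ⟨k, hk⟩ : ∃ k, L.word.get q = .rightCusp k := by
        rcases (show g = q ∨ g < q by omega) with rfl | hlt
        · exact ⟨k₀, by simpa using hr⟩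
        · rcases hk : L.word.get q with k | k | k
          · have h1 := hL.rank_le hlt hr (Front.getElem?_of_get hk)
            simp [Singularity.rank] at h1
          · have h1 := hL.rank_le hlt hr (Front.getElem?_of_get hk)
            simp [Singularity.rank] at h1
          · exact ⟨k, rfl⟩
      have hq := Front.getElem?_of_get hk
      have hke := hL.even_of_rightCusp hq
      have hs : C.strands (m + 1) = C.strands m - 2 := C.strands_succ ht hk
      have hf : k + 1 < C.strands m := C.fits ht hk
      -- Inserting two strands at an even position keeps the pair adjacent and its upper strand
      -- even.
      have hshift : shift k (i + 1) = shift k i + 1 ∧ Even (shift k i) := by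
        rcases hke with ⟨a, rfl⟩
        rcases hi with ⟨b, rfl⟩
        by_cases hlt : b + b < a + a
        · rw [shift_of_lt hlt, shift_of_lt (by omega)]
          exact ⟨rfl, b, rfl⟩
        · rw [shift_of_le (by omega), shift_of_le (by omega)]
          exact ⟨by omega, b + 1, by omega⟩
      rw [C.fullSum_rightCusp ht hk hke hi hj, hgap', Front.diskSum_rightCusp hq
        (Nat.lt_succ_self i) (by rwa [MarkedFront.strands, hgap'] at hj), hshift.1, ← C.gap_eq ht]
      refine ih (hC.settled ht (fun l => by rw [hk]; simp)) _ hshift.2 ?_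
      rw [← hshift.1, show C.strands m = C.strands (m + 1) + 2 by omega, shift_lt (by omega)]
      exact hj
    · exact absurd ht (hm m k l rfl)

/-- On the originating chord `fullSum` and `chordSum` differ by the coefficient `⟨d e_k, e_{k+1}⟩`.
It is `0` at a crossing; at a right cusp it is `1` and cancels the unit in `∂ a` modulo `2`. -/
theorem IsAForm.diffGen_eq_phiHom (hC : C.IsAForm) (hL : L.IsNearlyPlat) (a : L.Generator) :
    C.diffGen a = Front.phiHom C.augmentation (L.ceGen a) := by
  classical
  obtain ⟨m, hm⟩ := C.exists_tangle a.1
  have hgap := C.gap_eq hm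
  rcases a.2 with ⟨k, hk⟩ | ⟨k, hk⟩
  · have hf : k + 1 < C.strands m := C.fits hm hk
    have hcoeff : C.coeffAlg m k (k + 1) = 0 := by
      rw [coeffAlg, (C.crossing m a.1 k hm hk).1, map_zero]
    have hr : ∀ g k', g < C.gap m → L.word[g]? ≠ some (.rightCusp k') := by
      intro g k' hg h
      have h1 := hL.rank_le (hgap ▸ hg) h (Front.getElem?_of_get hk)
      simp [Singularity.rank] at h1
    rw [C.diffGen_eq hm (Or.inl hk), Front.ceGen_eq a (Or.inl hk), if_neg (by rw [hk]; simp),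
      zero_add, ← hgap, ← add_zero (C.chordSum m k (k + 1)), ← hcoeff]
    change C.fullSum m k (k + 1) = _
    by_cases hm' : C.Settled m
    · exact hC.fullSum_eq hL m hm' hr _ _ (Nat.lt_succ_self k) hf
    · simp only [Settled, not_forall, not_not] at hm'
      obtain ⟨n, k', l, rfl, hn⟩ := hm'
      have hn := hC.handleslide_of_crossing hm hk hn
      have hgn := C.gap_succ_handleslide hn
      rw [C.fullSum_handleslide hn (Nat.lt_succ_self k) hf, hgn, ← hC.fullSum_eq hL n
        (hC.settled_of_handleslide hn) (hgn ▸ hr) _ _ (Nat.lt_succ_self k)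
        (C.strands_handleslide hn ▸ hf)]
      -- The mark of `a` itself has no effect: both jumps would need a chord extending strictly
      -- beyond the mark.
      simp [slideStep]
  · have hf : k + 1 < C.strands m := C.fits hm hk
    have hcoeff : C.coeffAlg m k (k + 1) = 1 := by
      rw [coeffAlg, (C.rightCusp m a.1 k hm hk).1, map_one]
    have h2 : (1 : L.Alg) + 1 = 0 := by
      rw [← map_one (algebraMap (ZMod 2) L.Alg), ← map_add, zmod_two_add_self, map_zero]
    have h1 := hC.fullSum_pair_eq hL m (hC.settled hm (fun l => by rw [hk]; simp)) k
      (hL.even_of_rightCusp (Front.getElem?_of_get hk)) hf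
    rw [C.diffGen_eq hm (Or.inr hk), Front.ceGen_eq a (Or.inr hk), if_pos ⟨k, hk⟩, map_add, map_one,
      ← hgap, ← h1, fullSum, hcoeff, add_left_comm, h2, add_zero]

/-- Since `φ^ε` is an involution, both sides are derivations, so generators suffice. There `φ^ε (q)`
and `q` differ by a constant, which `∂` kills. -/
theorem IsAForm.diff_eq (hC : C.IsAForm) (hL : L.IsNearlyPlat) :
    C.diff = L.augDiff C.augmentation := by
  have h1 : ∀ x, L.augDiff C.augmentation x =
    Front.phiHom C.augmentation (L.ceDiff (Front.phiHom C.augmentation x)) := fun _ => rfl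
  ext x
  rw [h1]
  induction x using FreeAlgebra.induction with
  | grade0 r =>
    rw [AlgHom.commutes, diff, Front.ceDiff, leibnizExt_algebraMap, leibnizExt_algebraMap, map_zero]
  | grade1 q =>
    rw [Front.phiHom_ι, diff, Front.ceDiff, map_add, leibnizExt_algebraMap, leibnizExt_ι,
      leibnizExt_ι, add_zero, hC.diffGen_eq_phiHom hL]
  | mul x y hx hy =>
    have h2 : C.diff (x * y) = x * C.diff y + C.diff x * y := leibnizExt_mul _ _ _
    have h3 : ∀ x y, L.ceDiff (x * y) = x * L.ceDiff y + L.ceDiff x * y := leibnizExt_mul _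
    simp only [h2, h3, map_mul (Front.phiHom C.augmentation), map_add, Front.phiHom_phiHom, ← hx,
      ← hy]
  | add x y hx hy => rw [map_add, map_add, map_add, map_add, hx, hy]

/-! ### The augmentation property -/

/-- The constant term of an element of the algebra. -/
noncomputable def constantTerm (L : Front) : L.Alg →ₐ[ZMod 2] ZMod 2 :=
  FreeAlgebra.lift (ZMod 2) fun _ => 0

/-- Setting the generators to `0` after the translation `q ↦ q + ε(q)` evaluates at `ε`. -/
theorem constantTerm_phiHom (ε : L.Alg →ₐ[ZMod 2] ZMod 2) (x : L.Alg) :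
    constantTerm L (Front.phiHom ε x) = ε x := by
  have h : (constantTerm L).comp (Front.phiHom ε) = ε := by
    ext q
    simp only [Function.comp_apply, AlgHom.comp_apply, Front.phiHom_ι, map_add, AlgHom.commutes]
    simp [constantTerm]
  exact congrArg (fun F => F x) h

theorem constantTerm_monomial {w : List L.Generator} (hw : 1 ≤ w.length) :
    constantTerm L (Front.monomial w) = 0 := by
  cases w with
  | nil => simp at hw
  | cons q w => simp [Front.monomial, constantTerm]

theorem constantTerm_diffGen (C : MCS L μ) (a : L.Generator) : constantTerm L (C.diffGen a) = 0 := by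
  have hadd : ∀ x y : L.Alg, constantTerm L x = 0 → constantTerm L y = 0 →
      constantTerm L (x + y) = 0 := fun x y hx hy => by rw [map_add, hx, hy, add_zero]
  refine finsum_induction (fun x => constantTerm L x = 0) (map_zero _) hadd fun w => ?_
  refine finsum_induction (fun x => constantTerm L x = 0) (map_zero _) hadd fun hw => ?_
  rw [map_smul, constantTerm_monomial hw.1, smul_zero]

/-- On a generator, `ε(∂ q)` is the constant term of `φ^ε (∂ q) = d q`, which has none because chord
path words are nonempty; the Leibniz rule extends this to all of the algebra. -/
theorem IsAForm.isAugmentation (hC : C.IsAForm) (hL : L.IsNearlyPlat) :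
    Front.IsAugmentation μ C.augmentation := by
  refine ⟨fun x => ?_, fun q hq => ?_⟩
  · induction x using FreeAlgebra.induction with
    | grade0 r => rw [Front.ceDiff, leibnizExt_algebraMap, map_zero]
    | grade1 q =>
      rw [Front.ceDiff, leibnizExt_ι, ← constantTerm_phiHom, ← hC.diffGen_eq_phiHom hL,
        constantTerm_diffGen]
    | mul x y hx hy =>
      rw [Front.ceDiff] at hx hy ⊢
      rw [leibnizExt_mul, map_add, map_mul, map_mul, hx, hy, mul_zero, zero_mul, add_zero]
    | add x y hx hy => rw [map_add, map_add, hx, hy, add_zero]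
  · rw [augmentation_ι] at hq
    split_ifs at hq with h
    · obtain ⟨⟨k, hk⟩, m, k', l, h1, h2⟩ := h
      -- The mark joins the two strands that cross, so they have equal potential and the crossing
      -- has degree `0`.
      have h3 := (C.handleslide_mark m k (k + 1) (hC.handleslide_of_crossing h2 hk h1)).2.2
      rw [← C.gap_succ_handleslide h1, C.gap_eq h2] at h3
      rw [Front.degree_crossing μ hk, h3, sub_self]
    · simp at hq

end MCS

end Legendrian

theorem theorem7p2 (L : Legendrian.Front) (hL : L.IsNearlyPlat) (μ : L.MaslovPotential)
    (C : Legendrian.MCS L μ) (hC : C.IsAForm) :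
    Legendrian.Front.IsAugmentation μ C.augmentation ∧
      C.dga = Legendrian.Front.augDGA μ C.augmentation := by
  refine ⟨hC.isAugmentation hL, ?_⟩
  rw [Legendrian.MCS.dga, Legendrian.Front.augDGA, hC.diff_eq hL]
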